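/- **Setting.** Let $D$ be a probability distribution on pairs $(x,\ell)\in\mathcal X\times[0,1]^K$ (context, loss vector), and let $(x_t,\ell_t)_{t\ge1}$ be i.i.d. from $D$. Let $\Pi$ be a finite nonempty class of policies $\pi:\mathcal X\to\{1,\dots,K\}$. Put $L(\pi)=\mathbb E_{(x,\ell)\sim D}[\ell(\pi(x))]$, $\pi^*\in\arg\min_{\pi\in\Pi}L(\pi)$ and $\rho(\pi,\pi')=P_{x}(\pi(x)\neq\pi'(x))$. Let $0<\varepsilon\le1$, $0<\delta<1$ and, for $T\ge1$, $\delta_T=\delta/(T^2+T)$, $e_T=\log(2|\Pi|/\delta_T)/T$. **Algorithm (active $\varepsilon$-greedy).** In round $t$, given estimated loss vectors $\hat\ell_1,\dots,\hat\ell_{t-1}$, let $\hat L_{t-1}(\pi)=\frac1{t-1}\sum_{s<t}\hat\ell_s(\pi(x_s))$ (zero if $t=1$), and let $\pi_t\in\arg\min_{\pi\in\Pi}\hat L_{t-1}(\pi)$, with ties broken using past information only. Let $A_1=\{1,\dots,K\}$ and, for $t\ge2$, $$A_t=\Big\{a:\ \min_{\pi\in\Pi:\pi(x_t)=a}\hat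 L_{t-1}(\pi)-\hat L_{t-1}(\pi_t)\le\Delta_t\Big\},\qquad \Delta_t=2\Big(\sqrt{\tfrac{2K}{\varepsilon}}+1\Big)\sqrt{e_{t-1}}+\Big(\tfrac K\varepsilon+3\Big)e_{t-1}$$ (a minimum over the empty set is $+\infty$). Given the past, $x_t$ and $\ell_t$, the action $a_t$ is drawn from $p_t$, where $p_t(\pi_t(x_t))=1-(|A_t|-1)\varepsilon/K$, $p_t(a)=\varepsilon/K$ for $a\in A_t\setminus\{\pi_t(x_t)\}$, and $p_t(a)=0$ otherwise. Then $\hat\ell_t(a)=\frac{\mathbf 1\{a=a_t\}}{p_t(a_t)}\ell_t(a_t)$ for $a\in A_t$ and $\hat\ell_t(a)=1$ for $a\notin A_t$. Also put $\tilde\ell_t(a)=\ell_t(a)$ for $a\in A_t$ and $\tilde\ell_t(a)=1$ for $a\notin A_t$, and let $L_T(\pi),\tilde L_T(\pi)$ be the averages over $t\le T$ of $\ell_t(\pi(x_t))$, $\tilde\ell_t(\pi(x_t))$. The regret is $R_T=\sum_{t=1}^T\ell_t(a_t)-\sum_{t=1}^T\ell_t(\pi^*(x_t))$. **Event.** Let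 $\mathcal E$ be the event that for all $\pi\in\Pi$ and all $T\ge1$ $$\big|(\hat L_T(\pi)-\hat L_T(\pi^*))-(\tilde L_T(\pi)-\tilde L_T(\pi^*))\big|\le 2\sqrt{\tfrac{2K\rho(\pi,\pi^*)e_T}{\varepsilon}}+\Big(\tfrac K\varepsilon+1\Big)e_T,$$ $$\big|(L_T(\pi)-L_T(\pi^*))-(L(\pi)-L(\pi^*))\big|\le 2\sqrt{\rho(\pi,\pi^*)e_T}+2e_T.$$ **Theorem.** There is a universal constant $C>0$ such that in every such setting, without any noise assumption, $\Pr(\mathcal E)\ge1-\delta$ and, for every $T\ge1$, $$\mathbb E[R_T\mid\mathcal E]\le C\left(\sqrt{\frac{KT\log(T|\Pi|/\delta)}{\varepsilon}}+T\varepsilon\right).$$ For each $T\ge1$, the right-hand side is minimized over $\varepsilon\in(0,1]$ by $\varepsilon=\min\{1,(K\log(T|\Pi|/\delta)/(4T))^{1/3}\}$, and the algorithm run with this $\varepsilon$ satisfies $$\mathbb E[R_T\mid\mathcal E]\le C\,T^{2/3}\big(K\log(T|\Pi|/\delta)\big)^{1/3}.$$ -/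

import Mathlib

open MeasureTheory ProbabilityTheory

namespace ActiveGreedy

noncomputable section

/-- `e_T = log (2 N / δ_T) / T` with `δ_T = δ / (T² + T)`, where `N` is the number of policies. -/
def confTerm (N : ℕ) (δ : ℝ) (T : ℕ) : ℝ :=
  Real.log (2 * N / (δ / ((T : ℝ) ^ 2 + T))) / T

/-- The elimination threshold used after `T ≥ 1` completed rounds (that is, in round `T + 1`). -/
def threshold (K N : ℕ) (ε δ : ℝ) (T : ℕ) : ℝ :=
  2 * (√(2 * K / ε) + 1) * √(confTerm N δ T) + (K / ε + 3) * confTerm N δ T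

/-- The average loss `L(π, Z)` of a policy on the first `T` examples `(x t, c t)`;
it is `0` for the empty sample. -/
def empLoss {X : Type*} {K : ℕ} (x : ℕ → X) (c : ℕ → Fin K → ℝ) (T : ℕ) (π : X → Fin K) : ℝ :=
  (∑ t ∈ Finset.range T, c t (π (x t))) / T

/-- The expected loss `L(π)`. -/
def expLoss {X : Type*} [MeasurableSpace X] {K : ℕ} (D : Measure (X × (Fin K → ℝ)))
    (π : X → Fin K) : ℝ :=
  ∫ z, z.2 (π z.1) ∂D

/-- The expected disagreement `ρ(π, π')`. -/
def disagreement {X : Type*} [MeasurableSpace X] {K : ℕ} (D : Measure (X × (Fin K → ℝ)))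
    (π π' : X → Fin K) : ℝ :=
  D.real {z | π z.1 ≠ π' z.1}

/-- The probability of playing `b` when `A` is the set of explored actions and `g` is the
greedy action. -/
def playProb {K : ℕ} (ε : ℝ) (A : Finset (Fin K)) (g b : Fin K) : ℝ :=
  if b = g then 1 - ((A.card : ℝ) - 1) * ε / K else if b ∈ A then ε / K else 0

/-- The trajectories of an interaction. Rounds are numbered from `0`: the index `t` below refers
to round `t + 1` of the algorithm, so exactly `t` rounds are completed before it. -/
structure Interaction (X Ω : Type*) (K : ℕ) where
  /-- contexts -/
  x : ℕ → Ω → X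
  /-- full loss vectors -/
  loss : ℕ → Ω → Fin K → ℝ
  /-- actions played -/
  act : ℕ → Ω → Fin K
  /-- greedy policies -/
  greedy : ℕ → Ω → X → Fin K
  /-- sets of explored actions -/
  explored : ℕ → Ω → Finset (Fin K)

namespace Interaction

variable {X Ω : Type*} {K : ℕ}

/-- The probability with which the algorithm plays `b` in round `t`. -/
def prob (I : Interaction X Ω K) (ε : ℝ) (t : ℕ) (ω : Ω) (b : Fin K) : ℝ :=
  playProb ε (I.explored t ω) (I.greedy t ω (I.x t ω)) b

/-- The biased loss vector: unexplored actions get loss `1`. -/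
def biasedLoss (I : Interaction X Ω K) (t : ℕ) (ω : Ω) (b : Fin K) : ℝ :=
  if b ∈ I.explored t ω then I.loss t ω b else 1

/-- The inverse propensity estimate of the biased loss vector. -/
def ipsLoss (I : Interaction X Ω K) (ε : ℝ) (t : ℕ) (ω : Ω) (b : Fin K) : ℝ :=
  if b ∈ I.explored t ω then
    (if b = I.act t ω then I.loss t ω (I.act t ω) / I.prob ε t ω (I.act t ω) else 0)
  else 1

/-- `L_T(π)`: average of the true losses in the first `T` rounds. -/
def trueEmp (I : Interaction X Ω K) (T : ℕ) (ω : Ω) (π : X → Fin K) : ℝ :=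
  empLoss (fun t => I.x t ω) (fun t => I.loss t ω) T π

/-- Average of the biased losses in the first `T` rounds. -/
def biasedEmp (I : Interaction X Ω K) (T : ℕ) (ω : Ω) (π : X → Fin K) : ℝ :=
  empLoss (fun t => I.x t ω) (fun t => I.biasedLoss t ω) T π

/-- Average of the estimated losses in the first `T` rounds. -/
def ipsEmp (I : Interaction X Ω K) (ε : ℝ) (T : ℕ) (ω : Ω) (π : X → Fin K) : ℝ :=
  empLoss (fun t => I.x t ω) (fun t => I.ipsLoss ε t ω) T π

/-- The regret `R_T` with respect to the policy `πstar`. -/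
def regret (I : Interaction X Ω K) (πstar : X → Fin K) (T : ℕ) (ω : Ω) : ℝ :=
  ∑ t ∈ Finset.range T, I.loss t ω (I.act t ω)
    - ∑ t ∈ Finset.range T, I.loss t ω (πstar (I.x t ω))

/-- The event on which all deviation bounds hold, for all policies and all horizons. -/
def deviationEvent [MeasurableSpace X] (I : Interaction X Ω K) (D : Measure (X × (Fin K → ℝ)))
    (P : Finset (X → Fin K)) (πstar : X → Fin K) (ε δ : ℝ) : Set Ω :=
  {ω | ∀ π ∈ P, ∀ T : ℕ, 1 ≤ T →
    |(I.ipsEmp ε T ω π - I.ipsEmp ε T ω πstar) - (I.biasedEmp T ω π - I.biasedEmp T ω πstar)|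
      ≤ 2 * √(2 * K * disagreement D π πstar * confTerm P.card δ T / ε)
        + (K / ε + 1) * confTerm P.card δ T ∧
    |(I.trueEmp T ω π - I.trueEmp T ω πstar) - (expLoss D π - expLoss D πstar)|
      ≤ 2 * √(disagreement D π πstar * confTerm P.card δ T) + 2 * confTerm P.card δ T}

/-- `I` is a run of the analyzed active ε-greedy algorithm, with policy class `P` and parameters
`ε`, `δ`, on i.i.d. data from `D`. Here `ℱ t` is the information available after `t` rounds. -/
structure IsRun [MeasurableSpace X] [mΩ : MeasurableSpace Ω] (I : Interaction X Ω K)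
    (ℱ : Filtration ℕ mΩ) (μ : Measure Ω) (D : Measure (X × (Fin K → ℝ)))
    (P : Finset (X → Fin K)) (ε δ : ℝ) : Prop where
  measurable_x : ∀ t, Measurable[ℱ (t + 1)] (I.x t)
  measurable_loss : ∀ t, Measurable[ℱ (t + 1)] (I.loss t)
  measurable_act : ∀ t, Measurable[ℱ (t + 1)] (I.act t)
  /-- every pair of a context and a loss vector has law `D` … -/
  law : ∀ t, μ.map (fun ω => (I.x t ω, I.loss t ω)) = D
  /-- … and is independent of the past -/
  indep : ∀ t, Indep
    (MeasurableSpace.comap (fun ω => (I.x t ω, I.loss t ω)) inferInstance) (ℱ t) μ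
  /-- the greedy policy is chosen from past information, with any tie-breaking rule, … -/
  measurable_greedy : ∀ t, ∀ π ∈ P, MeasurableSet[ℱ t] {ω | I.greedy t ω = π}
  greedy_mem : ∀ t ω, I.greedy t ω ∈ P
  /-- … and minimizes the estimated loss on past data over the policy class -/
  greedy_min : ∀ t ω, ∀ π ∈ P, I.ipsEmp ε t ω (I.greedy t ω) ≤ I.ipsEmp ε t ω π
  /-- in the first round all actions are explored -/
  explored_zero : ∀ ω, I.explored 0 ω = Finset.univ
  /-- later, `b` is explored iff the least estimated loss of a policy choosing `b` exceeds
  the least estimated loss by at most the threshold (the class being finite, iff some policy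
  choosing `b` is within the threshold) -/
  mem_explored : ∀ t, 1 ≤ t → ∀ ω b, b ∈ I.explored t ω ↔
    ∃ π ∈ P, π (I.x t ω) = b ∧
      I.ipsEmp ε t ω π - I.ipsEmp ε t ω (I.greedy t ω) ≤ threshold K P.card ε δ t
  /-- given the past, the context and the losses, the action is drawn from `prob` -/
  act_law : ∀ t b,
    μ[{ω | I.act t ω = b}.indicator (fun _ => (1 : ℝ)) |
        ℱ t ⊔ MeasurableSpace.comap (fun ω => (I.x t ω, I.loss t ω)) inferInstance]
      =ᵐ[μ] fun ω => I.prob ε t ω b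

end Interaction

/-- The rate `√(K T log(T N / δ) / ε) + T ε`. -/
def rate (K N T : ℕ) (δ ε : ℝ) : ℝ :=
  √(K * T * Real.log (T * N / δ) / ε) + T * ε

/-- The choice of the exploration probability in `(0, 1]` that minimizes `rate`. -/
def tunedEps (K N T : ℕ) (δ : ℝ) : ℝ :=
  min 1 ((K * Real.log (T * N / δ) / (4 * T)) ^ (1 / 3 : ℝ))

end

end ActiveGreedy

namespace ActiveGreedy

/-! ### A Bernstein inequality for bounded martingale differences -/

/-! Concentration. Before the action of a round is drawn, the importance-weighted estimate is
unbiased for the biased loss. For two policies, the error of the estimated loss difference vanishes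
where they agree. Where they disagree its conditional variance is at most `2 * K / ε`, because every
explored action has probability at least `ε / K`. The context is independent of the past, so
averaging over it turns disagreement into the factor ρ. In the same way the true loss differences
have variance at most ρ. Bernstein's inequality for martingale differences
(`measure_sum_range_ge_le`) and a union bound over signs, policies and horizons then control the
deviation event. The inequality is used with exponent `-2L`, which squares the failure probability
for which the confidence term is designed. The event therefore has probability at least `1 - δ / 2`,
hence at least 1/2 for every δ, and conditioning on it costs at most a factor 2.

No noise assumption is needed because the bias favours the optimal policy. Unexplored actions are
charged the largest possible loss 1. While the optimal policy has always been explored, its biased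
average is its true average, and those of its competitors can only increase. Up to the threshold,
the estimated excess of the greedy policy over the optimal one thus dominates its true excess. This
single inequality is read twice in `star_le_and_gap_le`. The true excess is nonnegative, so the
optimal policy stays within the threshold and remains explored, which closes an induction. The
estimated excess is nonpositive, so the true excess is at most the threshold.

Regret. Given the past, a round costs at most the true excess of the greedy policy plus ε for
exploration (`condExp_roundRegret_le`). Thresholds of order `√(K log / (ε t))` sum to `√(K T log /
ε)`. The remaining martingale need not have mean zero on the deviation event, which depends on the
whole trajectory, but its L² norm is of order `√T` (`setIntegral_sum_regretNoise_le`). Balancing the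
two terms of the rate gives the power 2/3. When the optimal ε is capped at 1, the trivial bound `T`
on the regret suffices. -/

lemma two_mul_three_pow_le_factorial (n : ℕ) : 2 * 3 ^ n ≤ (n + 2).factorial := by
  induction n with
  | zero => simp
  | succ n ih =>
    rw [show n + 1 + 2 = (n + 2) + 1 by ring, Nat.factorial_succ, pow_succ]
    nlinarith

/-- From the quadratic term on, the exponential series is dominated by a geometric series of ratio
`b / 3`, since `(n + 2)! ≥ 2 * 3 ^ n`. -/
lemma exp_le_one_add_add_sq_div {x b : ℝ} (hx : |x| ≤ b) (hb : b < 3) :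
    Real.exp x ≤ 1 + x + x ^ 2 / (2 * (1 - b / 3)) := by
  have hb0 : 0 ≤ b := (abs_nonneg x).trans hx
  have h1 : HasSum (fun n : ℕ => x ^ n / n.factorial) (Real.exp x) := by
    rw [Real.exp_eq_exp_ℝ]
    exact NormedSpace.expSeries_div_hasSum_exp x
  have h2 := (hasSum_nat_add_iff' 2).mpr h1
  have h3 : HasSum (fun n : ℕ => x ^ 2 / 2 * (b / 3) ^ n) (x ^ 2 / 2 * (1 - b / 3)⁻¹) :=
    (hasSum_geometric_of_lt_one (by positivity) (by linarith)).mul_left _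
  have h4 := hasSum_le (fun n => ?_) h2 h3
  · simp only [Finset.sum_range_succ, Finset.sum_range_zero] at h4
    norm_num at h4
    have : x ^ 2 / (2 * (1 - b / 3)) = x ^ 2 / 2 * (1 - b / 3)⁻¹ := by
      rw [div_mul_eq_div_div, div_eq_mul_inv (x ^ 2 / 2)]
    rw [this]
    linarith
  · have hf : (2 * 3 ^ n : ℝ) ≤ ((n + 2).factorial : ℝ) := by
      exact_mod_cast two_mul_three_pow_le_factorial n
    have hxn : x ^ (n + 2) ≤ x ^ 2 * b ^ n := by
      have : x ^ n ≤ b ^ n :=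
        (le_abs_self _).trans (by rw [abs_pow]; exact pow_le_pow_left₀ (abs_nonneg x) hx n)
      rw [pow_add, mul_comm]
      exact mul_le_mul_of_nonneg_left this (sq_nonneg x)
    calc x ^ (n + 2) / ((n + 2).factorial : ℝ) ≤ x ^ 2 * b ^ n / ((n + 2).factorial : ℝ) := by
          gcongr
      _ ≤ x ^ 2 * b ^ n / (2 * 3 ^ n) := by gcongr
      _ = x ^ 2 / 2 * (b / 3) ^ n := by
          rw [div_pow]; field_simp

section Martingale

variable {Ω : Type*} {mΩ : MeasurableSpace Ω} {μ : Measure Ω}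

lemma integrable_of_ae_abs_le [IsFiniteMeasure μ] {f : Ω → ℝ} {R : ℝ} (hf : Measurable f)
    (h : ∀ᵐ ω ∂μ, |f ω| ≤ R) : Integrable f μ :=
  Integrable.of_bound hf.aestronglyMeasurable R h

lemma ae_abs_sum_range_le {d : ℕ → Ω → ℝ} {R : ℝ} (hbd : ∀ t, ∀ᵐ ω ∂μ, |d t ω| ≤ R) (T : ℕ) :
    ∀ᵐ ω ∂μ, |∑ t ∈ Finset.range T, d t ω| ≤ T * R := by
  filter_upwards [ae_all_iff.mpr hbd] with ω hω
  calc |∑ t ∈ Finset.range T, d t ω| ≤ ∑ t ∈ Finset.range T, |d t ω| :=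
        Finset.abs_sum_le_sum_abs _ _
    _ ≤ ∑ _t ∈ Finset.range T, R := Finset.sum_le_sum fun t _ => hω t
    _ = T * R := by simp

lemma measurable_sum_range {ℱ : Filtration ℕ mΩ} {d : ℕ → Ω → ℝ}
    (hd : ∀ t, Measurable[ℱ (t + 1)] (d t)) (T : ℕ) :
    Measurable[ℱ T] (fun ω => ∑ t ∈ Finset.range T, d t ω) := by
  refine Finset.measurable_fun_sum _ fun t ht => ?_
  exact (hd t).mono (ℱ.mono (Nat.succ_le_of_lt (Finset.mem_range.mp ht))) le_rfl

variable [IsProbabilityMeasure μ]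

/-- The conditional moment generating function of a bounded, conditionally centered variable. -/
lemma condExp_exp_le {m : MeasurableSpace Ω} (hm : m ≤ mΩ) {f : Ω → ℝ} {R v l : ℝ}
    (hf : Measurable[mΩ] f) (hbd : ∀ᵐ ω ∂μ, |f ω| ≤ R) (hmean : μ[f | m] =ᵐ[μ] 0)
    (hvar : μ[fun ω => f ω ^ 2 | m] ≤ᵐ[μ] fun _ => v) (hl : 0 ≤ l) (hlR : l * R < 3) :
    μ[fun ω => Real.exp (l * f ω) | m]
      ≤ᵐ[μ] fun _ => Real.exp (l ^ 2 * v / (2 * (1 - l * R / 3))) := by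
  set c : ℝ := l ^ 2 / (2 * (1 - l * R / 3)) with hc
  have hc0 : 0 ≤ c := div_nonneg (sq_nonneg l) (by linarith)
  have hfi : Integrable f μ := integrable_of_ae_abs_le hf hbd
  have hf2i : Integrable (fun ω => f ω ^ 2) μ := by
    refine integrable_of_ae_abs_le (R := R ^ 2) (hf.pow_const 2) ?_
    filter_upwards [hbd] with ω hω
    rw [abs_pow]; exact pow_le_pow_left₀ (abs_nonneg _) hω 2
  have hei : Integrable (fun ω => Real.exp (l * f ω)) μ := by
    refine integrable_of_ae_abs_le (R := Real.exp (l * R)) (by fun_prop) ?_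
    filter_upwards [hbd] with ω hω
    rw [Real.abs_exp]
    exact Real.exp_le_exp.mpr (mul_le_mul_of_nonneg_left ((le_abs_self _).trans hω) hl)
  have h1 : μ[fun ω => Real.exp (l * f ω) | m]
      ≤ᵐ[μ] μ[(fun _ => (1 : ℝ)) + (l • f + c • fun ω => f ω ^ 2) | m] := by
    refine condExp_mono hei ((integrable_const _).add ((hfi.smul l).add (hf2i.smul c))) ?_
    filter_upwards [hbd] with ω hω
    have := exp_le_one_add_add_sq_div (x := l * f ω) (b := l * R)
      (by rw [abs_mul, abs_of_nonneg hl]; exact mul_le_mul_of_nonneg_left hω hl) hlR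
    simp only [Pi.add_apply, Pi.smul_apply, smul_eq_mul]
    calc _ ≤ _ := this
      _ = _ := by rw [hc]; ring
  have h2 := condExp_add (integrable_const (1 : ℝ)) ((hfi.smul l).add (hf2i.smul c)) m (μ := μ)
  have h3 := condExp_add (hfi.smul l) (hf2i.smul c) m
  have h4 := condExp_smul (μ := μ) l f m
  have h5 := condExp_smul (μ := μ) c (fun ω => f ω ^ 2) m
  have h6 := condExp_const (μ := μ) hm (1 : ℝ)
  filter_upwards [h1, h2, h3, h4, h5, hmean, hvar] with ω h1 h2 h3 h4 h5 h7 h8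
  rw [h2, Pi.add_apply, h3, Pi.add_apply, h4, h5, Pi.smul_apply, Pi.smul_apply, h7, h6] at h1
  simp only [Pi.zero_apply, smul_eq_mul, mul_zero, zero_add] at h1
  calc _ ≤ _ := h1
    _ ≤ 1 + c * v := by gcongr
    _ ≤ Real.exp (c * v) := by linarith [Real.add_one_le_exp (c * v)]
    _ = _ := by rw [hc]; ring_nf

/-- Induction on `T`: the exponential of the first `T` increments is known at time `T`, so it is
pulled out of the conditional expectation and the last increment contributes one factor `exp ψ`. -/
lemma mgf_sum_range_le {ℱ : Filtration ℕ mΩ} {d : ℕ → Ω → ℝ} {R v l : ℝ}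
    (hd : ∀ t, Measurable[ℱ (t + 1)] (d t)) (hbd : ∀ t, ∀ᵐ ω ∂μ, |d t ω| ≤ R)
    (hmean : ∀ t, μ[d t | ℱ t] =ᵐ[μ] 0)
    (hvar : ∀ t, μ[fun ω => d t ω ^ 2 | ℱ t] ≤ᵐ[μ] fun _ => v)
    (hl : 0 ≤ l) (hlR : l * R < 3) (T : ℕ) :
    mgf (fun ω => ∑ t ∈ Finset.range T, d t ω) μ l
      ≤ Real.exp (T * (l ^ 2 * v / (2 * (1 - l * R / 3)))) := by
  set ψ := l ^ 2 * v / (2 * (1 - l * R / 3)) with hψ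
  have hint : ∀ f : Ω → ℝ, Measurable f → ∀ C, (∀ᵐ ω ∂μ, |f ω| ≤ C) →
      Integrable (fun ω => Real.exp (l * f ω)) μ := by
    intro f hf C hC
    refine integrable_of_ae_abs_le (R := Real.exp (l * C)) (by fun_prop) ?_
    filter_upwards [hC] with ω hω
    rw [Real.abs_exp]
    exact Real.exp_le_exp.mpr (mul_le_mul_of_nonneg_left ((le_abs_self _).trans hω) hl)
  induction T with
  | zero => simp [mgf]
  | succ T ih =>
    set S : Ω → ℝ := fun ω => ∑ t ∈ Finset.range T, d t ω with hS
    have hSm : Measurable[ℱ T] S := measurable_sum_range hd T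
    have hSm' : Measurable S := hSm.mono (ℱ.le T) le_rfl
    have hdm : Measurable (d T) := (hd T).mono (ℱ.le _) le_rfl
    have hSi := hint S hSm' _ (ae_abs_sum_range_le hbd T)
    have hdi := hint (d T) hdm _ (hbd T)
    have hprod : (fun ω => Real.exp (l * ∑ t ∈ Finset.range (T + 1), d t ω))
        = (fun ω => Real.exp (l * S ω)) * fun ω => Real.exp (l * d T ω) := by
      ext ω
      simp only [Finset.sum_range_succ, Pi.mul_apply, ← Real.exp_add, hS, mul_add]
    have hpi : Integrable ((fun ω => Real.exp (l * S ω)) * fun ω => Real.exp (l * d T ω)) μ := by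
      rw [← hprod]
      exact hint _ ((measurable_sum_range hd (T + 1)).mono (ℱ.le _) le_rfl) _
        (ae_abs_sum_range_le hbd (T + 1))
    have hpull := condExp_mul_of_stronglyMeasurable_left (μ := μ) (m := ℱ T)
      (Measurable.stronglyMeasurable (by fun_prop : Measurable[ℱ T] fun ω => Real.exp (l * S ω)))
      hpi hdi
    have hce := condExp_exp_le (ℱ.le T) hdm (hbd T) (hmean T) (hvar T) hl hlR
    calc mgf (fun ω => ∑ t ∈ Finset.range (T + 1), d t ω) μ l
        = ∫ ω, ((fun ω => Real.exp (l * S ω)) * fun ω => Real.exp (l * d T ω)) ω ∂μ := by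
          rw [mgf, hprod]
      _ = ∫ ω, (μ[(fun ω => Real.exp (l * S ω)) * fun ω => Real.exp (l * d T ω) | ℱ T]) ω ∂μ :=
          (integral_condExp (ℱ.le T)).symm
      _ ≤ ∫ ω, Real.exp (l * S ω) * Real.exp ψ ∂μ := by
          refine integral_mono_ae integrable_condExp (hSi.mul_const _) ?_
          filter_upwards [hpull, hce] with ω h1 h2
          rw [h1, Pi.mul_apply]
          exact mul_le_mul_of_nonneg_left h2 (Real.exp_pos _).le
      _ = mgf S μ l * Real.exp ψ := by rw [integral_mul_const, mgf]
      _ ≤ Real.exp (T * ψ) * Real.exp ψ := by gcongr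
      _ = _ := by rw [← Real.exp_add]; push_cast; ring_nf

/-- Choice of the Chernoff parameter for deviation `2√(VL) + RL` and exponent `-2L`. With `q = √(L /
V)`, the choice `l = 2q / (1 + 2qR/3)` is the usual Bernstein one. -/
lemma exists_bernstein_parameter {V R L : ℝ} (hV : 0 ≤ V) (hR : 0 < R) (hL : 0 ≤ L) :
    ∃ l : ℝ, 0 ≤ l ∧ l * R < 3 ∧
      2 * L ≤ l * (2 * √(V * L) + R * L) - l ^ 2 * V / (2 * (1 - l * R / 3)) := by
  rcases hV.eq_or_lt with rfl | hV
  -- Without variance the quadratic cost disappears and `l * R = 2` already gives `2L`; here `√(L /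
  -- V)` would degenerate to 0.
  · refine ⟨2 / R, by positivity, by field_simp; norm_num, ?_⟩
    simp only [zero_mul, Real.sqrt_zero, mul_zero, zero_div, sub_zero, zero_add]
    exact le_of_eq (by field_simp)
  · set q := √(L / V) with hq
    have hq0 : 0 ≤ q := Real.sqrt_nonneg _
    have hq2 : q ^ 2 * V = L := by rw [hq, Real.sq_sqrt (by positivity)]; field_simp
    have hs : √(V * L) = q * V := by
      rw [← hq2, show V * (q ^ 2 * V) = (q * V) ^ 2 by ring, Real.sqrt_sq (by positivity)]
    set w := 1 + 2 * q * R / 3 with hw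
    have hw1 : 0 < w := by positivity
    have h1 : 1 - 2 * q / w * R / 3 = 1 / w := by field_simp; rw [hw]; ring
    refine ⟨2 * q / w, by positivity, ?_, ?_⟩
    · have : 0 < 1 / w := by positivity
      linarith
    · rw [h1, hs]
      have h2 : 2 * q / w * (2 * (q * V) + R * L) - (2 * q / w) ^ 2 * V / (2 * (1 / w))
          = (2 * L + 2 * q * R * L) / w := by
        rw [← hq2]; field_simp; ring
      -- The claim becomes `2L + (4/3) q R L ≤ 2L + 2 q R L`: the linear term `R * L` is larger than
      -- the `(2/3) R * L` that Bernstein requires.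
      rw [h2, le_div_iff₀ hw1, hw]
      nlinarith [mul_nonneg (mul_nonneg hq0 hR.le) hL]

/-- **Bernstein's inequality** for bounded martingale differences whose conditional variances are
bounded by a constant. -/
theorem measure_sum_range_ge_le {ℱ : Filtration ℕ mΩ} {d : ℕ → Ω → ℝ} {R v L : ℝ}
    (hd : ∀ t, Measurable[ℱ (t + 1)] (d t)) (hbd : ∀ t, ∀ᵐ ω ∂μ, |d t ω| ≤ R)
    (hmean : ∀ t, μ[d t | ℱ t] =ᵐ[μ] 0)
    (hvar : ∀ t, μ[fun ω => d t ω ^ 2 | ℱ t] ≤ᵐ[μ] fun _ => v)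
    (hv : 0 ≤ v) (hR : 0 < R) (hL : 0 ≤ L) (T : ℕ) :
    μ.real {ω | 2 * √(T * v * L) + R * L ≤ ∑ t ∈ Finset.range T, d t ω}
      ≤ Real.exp (-(2 * L)) := by
  obtain ⟨l, hl, hlR, hlL⟩ := exists_bernstein_parameter (V := T * v) (by positivity) hR hL
  have hint : Integrable (fun ω => Real.exp (l * ∑ t ∈ Finset.range T, d t ω)) μ := by
    refine integrable_of_ae_abs_le (R := Real.exp (l * (T * R))) ?_ ?_
    · have : Measurable (fun ω => ∑ t ∈ Finset.range T, d t ω) :=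
        (measurable_sum_range hd T).mono (ℱ.le _) le_rfl
      fun_prop
    · filter_upwards [ae_abs_sum_range_le hbd T] with ω hω
      rw [Real.abs_exp]
      exact Real.exp_le_exp.mpr (mul_le_mul_of_nonneg_left ((le_abs_self _).trans hω) hl)
  refine (measure_ge_le_exp_mul_mgf _ hl hint).trans ?_
  refine (mul_le_mul_of_nonneg_left (mgf_sum_range_le hd hbd hmean hvar hl hlR T)
    (Real.exp_pos _).le).trans ?_
  rw [← Real.exp_add, Real.exp_le_exp]
  have : (T : ℝ) * (l ^ 2 * v / (2 * (1 - l * R / 3)))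
      = l ^ 2 * (T * v) / (2 * (1 - l * R / 3)) := by ring
  rw [this]
  linarith

/-- The two-sided version of `measure_sum_range_ge_le`, for averages. -/
theorem measure_abs_average_gt_le {ℱ : Filtration ℕ mΩ} {d : ℕ → Ω → ℝ} {R v e : ℝ}
    (hd : ∀ t, Measurable[ℱ (t + 1)] (d t)) (hbd : ∀ t, ∀ᵐ ω ∂μ, |d t ω| ≤ R)
    (hmean : ∀ t, μ[d t | ℱ t] =ᵐ[μ] 0)
    (hvar : ∀ t, μ[fun ω => d t ω ^ 2 | ℱ t] ≤ᵐ[μ] fun _ => v)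
    (hv : 0 ≤ v) (hR : 0 < R) (he : 0 ≤ e) {T : ℕ} (hT : 1 ≤ T) :
    μ.real {ω | 2 * √(v * e) + R * e < |(∑ t ∈ Finset.range T, d t ω) / T|}
      ≤ 2 * Real.exp (-(2 * (T * e))) := by
  have hT0 : (0 : ℝ) < T := by exact_mod_cast hT
  have hneg : ∀ t, μ[fun ω => -d t ω | ℱ t] =ᵐ[μ] 0 := by
    intro t
    filter_upwards [condExp_neg (μ := μ) (d t) (ℱ t), hmean t] with ω h1 h2
    have h3 : (μ[fun ω => -d t ω | ℱ t]) ω = (-μ[d t | ℱ t]) ω := h1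
    rw [h3, Pi.neg_apply, h2]; simp
  have hu := measure_sum_range_ge_le (L := T * e) hd hbd hmean hvar hv hR (by positivity) T
  have hl := measure_sum_range_ge_le (d := fun t ω => -d t ω) (R := R) (v := v) (L := T * e)
    (fun t => (hd t).neg) (by simpa using hbd) hneg (by simpa using hvar) hv hR (by positivity) T
  have hs : 2 * √(T * v * (T * e)) + R * (T * e) = T * (2 * √(v * e) + R * e) := by
    rw [show T * v * (T * e) = (T : ℝ) ^ 2 * (v * e) by ring, Real.sqrt_mul (by positivity),
      Real.sqrt_sq hT0.le]
    ring
  rw [hs] at hu hl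
  calc _ ≤ μ.real ({ω | T * (2 * √(v * e) + R * e) ≤ ∑ t ∈ Finset.range T, d t ω}
        ∪ {ω | T * (2 * √(v * e) + R * e) ≤ ∑ t ∈ Finset.range T, -d t ω}) := by
        refine measureReal_mono (fun ω hω => ?_)
        simp only [Set.mem_ofPred_eq, abs_div, Nat.abs_cast, lt_div_iff₀ hT0] at hω
        simp only [Set.mem_union, Set.mem_ofPred_eq, Finset.sum_neg_distrib]
        rcases lt_abs.mp hω with h | h
        · left; linarith
        · right; linarith
    _ ≤ _ := measureReal_union_le _ _
    _ ≤ _ := by linarith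

/-- Orthogonality of martingale differences. -/
lemma integral_sum_range_sq_le {ℱ : Filtration ℕ mΩ} {d : ℕ → Ω → ℝ} {R : ℝ}
    (hd : ∀ t, Measurable[ℱ (t + 1)] (d t)) (hbd : ∀ t, ∀ᵐ ω ∂μ, |d t ω| ≤ R)
    (hmean : ∀ t, μ[d t | ℱ t] =ᵐ[μ] 0) (T : ℕ) :
    ∫ ω, (∑ t ∈ Finset.range T, d t ω) ^ 2 ∂μ ≤ T * R ^ 2 := by
  induction T with
  | zero => simp
  | succ T ih =>
    set S : Ω → ℝ := fun ω => ∑ t ∈ Finset.range T, d t ω with hS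
    have hSm : Measurable[ℱ T] S := measurable_sum_range hd T
    have hSm' : Measurable S := hSm.mono (ℱ.le T) le_rfl
    have hdm : Measurable (d T) := (hd T).mono (ℱ.le _) le_rfl
    have hSb : ∀ᵐ ω ∂μ, |S ω| ≤ T * R := ae_abs_sum_range_le hbd T
    have hSi : Integrable (fun ω => S ω ^ 2) μ := by
      refine integrable_of_ae_abs_le (R := (T * R) ^ 2) (hSm'.pow_const 2) ?_
      filter_upwards [hSb] with ω hω
      rw [abs_pow]; exact pow_le_pow_left₀ (abs_nonneg _) hω 2
    have hSdi : Integrable (S * d T) μ := by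
      refine integrable_of_ae_abs_le (R := (T * R) * R) (hSm'.mul hdm) ?_
      filter_upwards [hSb, hbd T] with ω h1 h2
      rw [Pi.mul_apply, abs_mul]
      exact mul_le_mul h1 h2 (abs_nonneg _) ((abs_nonneg _).trans h1)
    have hcross : ∫ ω, (S * d T) ω ∂μ = 0 := by
      rw [← integral_condExp (ℱ.le T)]
      refine integral_eq_zero_of_ae ?_
      filter_upwards [condExp_mul_of_stronglyMeasurable_left (μ := μ) (m := ℱ T)
        hSm.stronglyMeasurable hSdi (integrable_of_ae_abs_le hdm (hbd T)), hmean T] with ω h1 h2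
      rw [h1, Pi.mul_apply, h2]; simp
    have hdi : ∀ᵐ ω ∂μ, (d T ω) ^ 2 ≤ R ^ 2 := by
      filter_upwards [hbd T] with ω hω
      rw [← sq_abs]; exact pow_le_pow_left₀ (abs_nonneg _) hω 2
    calc ∫ ω, (∑ t ∈ Finset.range (T + 1), d t ω) ^ 2 ∂μ
        ≤ ∫ ω, (S ω ^ 2 + 2 * (S * d T) ω + R ^ 2) ∂μ := by
          refine integral_mono_of_nonneg (.of_forall fun ω => sq_nonneg _)
            ((hSi.add (hSdi.const_mul 2)).add (integrable_const _)) ?_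
          filter_upwards [hdi] with ω hω
          simp only [Finset.sum_range_succ, Pi.mul_apply, hS]
          nlinarith
      _ = ∫ ω, S ω ^ 2 ∂μ + R ^ 2 := by
          have h := integral_add hSi (hSdi.const_mul 2)
          rw [integral_const_mul, hcross] at h
          rw [integral_add (f := fun ω => S ω ^ 2 + 2 * (S * d T) ω) (hSi.add (hSdi.const_mul 2))
            (integrable_const _), h]
          simp
      _ ≤ _ := by push_cast; linarith

end Martingale

/-! ### Confidence terms and action probabilities -/

lemma confTerm_nonneg {N : ℕ} {δ : ℝ} (hN : 1 ≤ N) (hδ : 0 < δ) (hδ1 : δ < 1) (T : ℕ) :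
    0 ≤ confTerm N δ T := by
  rcases Nat.eq_zero_or_pos T with rfl | hT
  · simp [confTerm]
  have hT1 : (1 : ℝ) ≤ T := by exact_mod_cast hT
  have hN1 : (1 : ℝ) ≤ N := by exact_mod_cast hN
  refine div_nonneg (Real.log_nonneg ?_) (by positivity)
  rw [le_div_iff₀ (by positivity), one_mul, div_le_iff₀ (by positivity)]
  nlinarith [mul_nonneg (sub_nonneg.mpr hN1) (sub_nonneg.mpr hT1), sq_nonneg (T : ℝ)]

lemma threshold_nonneg {K N : ℕ} {ε δ : ℝ} (hN : 1 ≤ N) (hδ : 0 < δ) (hδ1 : δ < 1) (hε : 0 < ε)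
    (T : ℕ) : 0 ≤ threshold K N ε δ T := by
  have := confTerm_nonneg hN hδ hδ1 T
  unfold threshold
  positivity

section PlayProb

variable {K : ℕ} {ε : ℝ} {A : Finset (Fin K)} {g : Fin K}

/-- The law is `ε / K` on each element of `A`, plus the remaining mass `1 - |A| ε / K` at `g`.
Membership of `g` in `A` makes the two parts add up. -/
lemma playProb_sum (hg : g ∈ A) : ∑ b, playProb ε A g b = 1 := by
  have h1 : ∀ b, playProb ε A g b = (if b = g then 1 - (A.card : ℝ) * ε / K else 0)
      + if b ∈ A then ε / K else 0 := by
    intro b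
    unfold playProb
    by_cases hb : b = g
    · subst hb; simp only [if_true, if_pos hg]; ring
    · simp [hb]
  simp only [h1, Finset.sum_add_distrib, Finset.sum_ite_eq', Finset.mem_univ, if_true,
    Finset.sum_ite_mem, Finset.univ_inter, Finset.sum_const, nsmul_eq_mul]
  ring

lemma card_sub_one_mul_le (hε : 0 ≤ ε) : ((A.card : ℝ) - 1) * ε / K ≤ ε - ε / K := by
  have hcard : (A.card : ℝ) ≤ K := by exact_mod_cast card_finset_fin_le A
  rcases Nat.eq_zero_or_pos K with rfl | hK
  · simpa using hε
  have hK0 : (0 : ℝ) < K := by exact_mod_cast hK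
  rw [div_le_iff₀ hK0, sub_mul ε, div_mul_cancel₀ _ hK0.ne']
  nlinarith

lemma le_playProb (hε : 0 ≤ ε) (hε1 : ε ≤ 1) {b : Fin K} (hb : b ∈ A) :
    ε / K ≤ playProb ε A g b := by
  unfold playProb
  split_ifs
  · linarith [card_sub_one_mul_le (K := K) (A := A) hε]
  · rfl

lemma playProb_nonneg (hε : 0 ≤ ε) (hε1 : ε ≤ 1) (b : Fin K) : 0 ≤ playProb ε A g b := by
  have hK : 0 ≤ ε / K := by positivity
  unfold playProb
  split_ifs
  · linarith [card_sub_one_mul_le (K := K) (A := A) hε]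
  · exact hK
  · rfl

lemma one_sub_le_playProb_self (hε : 0 ≤ ε) : 1 - ε ≤ playProb ε A g g := by
  have hK : 0 ≤ ε / K := by positivity
  unfold playProb
  rw [if_pos rfl]
  linarith [card_sub_one_mul_le (K := K) (A := A) hε]

end PlayProb

/-! ### Measurability of the trajectories -/

section Measurability

variable {Ω X : Type*} {K : ℕ}

lemma measurable_fin_of_preimage {m : MeasurableSpace Ω} {a : Ω → Fin K}
    (ha : ∀ b, MeasurableSet (a ⁻¹' {b})) : Measurable a :=
  measurable_to_countable' ha

/-- Evaluation at a random index is a finite sum of indicators, so joint measurability is not an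
issue. -/
lemma measurable_eval_fin {m : MeasurableSpace Ω} {F : Fin K → Ω → ℝ} {a : Ω → Fin K}
    (hF : ∀ b, Measurable (F b)) (ha : Measurable a) : Measurable fun ω => F (a ω) ω := by
  have : (fun ω => F (a ω) ω) = fun ω => ∑ b, if a ω = b then F b ω else 0 := by
    ext ω; simp
  rw [this]
  exact Finset.measurable_fun_sum _ fun b _ =>
    Measurable.ite (ha (measurableSet_singleton b)) (hF b) measurable_const

lemma measurable_playProb {m : MeasurableSpace Ω} {ε : ℝ} {A : Ω → Finset (Fin K)}
    {g : Ω → Fin K} (hA : ∀ b, MeasurableSet {ω | b ∈ A ω}) (hg : Measurable g) (b : Fin K) :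
    Measurable fun ω => playProb ε (A ω) (g ω) b := by
  have hcard : Measurable fun ω => ((A ω).card : ℝ) := by
    have : (fun ω => ((A ω).card : ℝ)) = fun ω => ∑ b, if b ∈ A ω then (1 : ℝ) else 0 := by
      ext ω; simp
    rw [this]
    exact Finset.measurable_fun_sum _ fun b _ =>
      Measurable.ite (hA b) measurable_const measurable_const
  unfold playProb
  refine Measurable.ite ?_ (by fun_prop) (Measurable.ite (hA b) measurable_const measurable_const)
  have : {ω | b = g ω} = g ⁻¹' {b} := by ext; simp [eq_comm]
  rw [this]
  exact hg (measurableSet_singleton b)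

end Measurability

namespace Interaction

variable {X Ω : Type*} {K : ℕ}

/-- The estimate of the biased loss of `c` that results from playing `a` in round `t`. -/
noncomputable def ipsIfPlayed (I : Interaction X Ω K) (ε : ℝ) (t : ℕ) (a c : Fin K) (ω : Ω) : ℝ :=
  if c ∈ I.explored t ω then (if c = a then I.loss t ω a / I.prob ε t ω a else 0) else 1

variable [MeasurableSpace X] [mΩ : MeasurableSpace Ω]

/-- The information available when the action of round `t` is drawn. -/
abbrev preAct (I : Interaction X Ω K) (ℱ : Filtration ℕ mΩ) (t : ℕ) : MeasurableSpace Ω :=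
  ℱ t ⊔ MeasurableSpace.comap (fun ω => (I.x t ω, I.loss t ω)) inferInstance

namespace IsRun

variable {I : Interaction X Ω K} {ℱ : Filtration ℕ mΩ} {μ : Measure Ω}
  {D : Measure (X × (Fin K → ℝ))} {P : Finset (X → Fin K)} {ε δ : ℝ}

lemma le_preAct (I : Interaction X Ω K) (ℱ : Filtration ℕ mΩ) (t : ℕ) : ℱ t ≤ I.preAct ℱ t :=
  le_sup_left

lemma measurable_data (h : I.IsRun ℱ μ D P ε δ) (t : ℕ) :
    Measurable[ℱ (t + 1)] fun ω => (I.x t ω, I.loss t ω) :=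
  (h.measurable_x t).prodMk (h.measurable_loss t)

lemma preAct_le_succ (h : I.IsRun ℱ μ D P ε δ) (t : ℕ) : I.preAct ℱ t ≤ ℱ (t + 1) :=
  sup_le (ℱ.mono (Nat.le_succ t)) (h.measurable_data t).comap_le

lemma preAct_le (h : I.IsRun ℱ μ D P ε δ) (t : ℕ) : I.preAct ℱ t ≤ mΩ :=
  (h.preAct_le_succ t).trans (ℱ.le _)

lemma measurable_data_preAct (I : Interaction X Ω K) (ℱ : Filtration ℕ mΩ) (t : ℕ) :
    Measurable[I.preAct ℱ t] fun ω => (I.x t ω, I.loss t ω) :=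
  (comap_measurable _).mono le_sup_right le_rfl

lemma measurable_x_preAct (I : Interaction X Ω K) (ℱ : Filtration ℕ mΩ) (t : ℕ) :
    Measurable[I.preAct ℱ t] (I.x t) :=
  measurable_fst.comp (measurable_data_preAct I ℱ t)

lemma measurable_loss_preAct (I : Interaction X Ω K) (ℱ : Filtration ℕ mΩ) (t : ℕ) (b : Fin K) :
    Measurable[I.preAct ℱ t] fun ω => I.loss t ω b :=
  (measurable_pi_apply b).comp (measurable_snd.comp (measurable_data_preAct I ℱ t))

lemma measurable_policy_preAct (I : Interaction X Ω K) (ℱ : Filtration ℕ mΩ) (t : ℕ)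
    {π : X → Fin K} (hπ : Measurable π) : Measurable[I.preAct ℱ t] fun ω => π (I.x t ω) :=
  hπ.comp (measurable_x_preAct I ℱ t)

lemma measurable_greedyAction (h : I.IsRun ℱ μ D P ε δ) (hP : ∀ π ∈ P, Measurable π) (t : ℕ) :
    Measurable[I.preAct ℱ t] fun ω => I.greedy t ω (I.x t ω) := by
  refine measurable_fin_of_preimage fun b => ?_
  have : (fun ω => I.greedy t ω (I.x t ω)) ⁻¹' {b}
      = ⋃ π ∈ P, {ω | I.greedy t ω = π} ∩ (fun ω => π (I.x t ω)) ⁻¹' {b} := by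
    ext ω
    simp only [Set.mem_preimage, Set.mem_singleton_iff, Set.mem_iUnion, Set.mem_inter_iff,
      Set.mem_ofPred_eq, exists_prop]
    constructor
    · intro hb
      exact ⟨_, h.greedy_mem t ω, rfl, hb⟩
    · rintro ⟨π, -, rfl, hb⟩
      exact hb
  rw [this]
  refine MeasurableSet.biUnion P.countable_toSet fun π hπ => ?_
  exact (le_preAct I ℱ t _ (h.measurable_greedy t π hπ)).inter
    (measurable_policy_preAct I ℱ t (hP π hπ) (measurableSet_singleton b))

/-- The lemmas ending in `_of` take measurability of the explored sets as a hypothesis. It is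
supplied by `measurableSet_explored`, whose induction itself uses them for earlier rounds. -/
lemma measurable_prob_of (h : I.IsRun ℱ μ D P ε δ) (hP : ∀ π ∈ P, Measurable π) {t : ℕ}
    (hA : ∀ b, MeasurableSet[I.preAct ℱ t] {ω | b ∈ I.explored t ω}) (b : Fin K) :
    Measurable[I.preAct ℱ t] fun ω => I.prob ε t ω b :=
  measurable_playProb hA (h.measurable_greedyAction hP t) b

lemma measurable_ipsIfPlayed_of (h : I.IsRun ℱ μ D P ε δ) (hP : ∀ π ∈ P, Measurable π) {t : ℕ}
    (hA : ∀ b, MeasurableSet[I.preAct ℱ t] {ω | b ∈ I.explored t ω}) (a c : Fin K) :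
    Measurable[I.preAct ℱ t] (I.ipsIfPlayed ε t a c) := by
  unfold ipsIfPlayed
  refine Measurable.ite (hA c) ?_ measurable_const
  by_cases hca : c = a
  · simp only [hca, if_true]
    exact (measurable_loss_preAct I ℱ t a).div (h.measurable_prob_of hP hA a)
  · simp only [hca, if_false]
    exact measurable_const

lemma measurable_ipsLoss_policy_of (h : I.IsRun ℱ μ D P ε δ) (hP : ∀ π ∈ P, Measurable π)
    {t : ℕ} (hA : ∀ b, MeasurableSet[I.preAct ℱ t] {ω | b ∈ I.explored t ω})
    {π : X → Fin K} (hπ : Measurable π) :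
    Measurable[ℱ (t + 1)] fun ω => I.ipsLoss ε t ω (π (I.x t ω)) := by
  refine measurable_eval_fin (F := fun c ω => I.ipsLoss ε t ω c) (fun c => ?_)
    (hπ.comp (h.measurable_x t))
  refine measurable_eval_fin (F := fun a ω => I.ipsIfPlayed ε t a c ω) (fun a => ?_)
    (h.measurable_act t)
  exact (h.measurable_ipsIfPlayed_of hP hA a c).mono (h.preAct_le_succ t) le_rfl

lemma measurable_ipsEmp_of (h : I.IsRun ℱ μ D P ε δ) (hP : ∀ π ∈ P, Measurable π)
    {t : ℕ} (hA : ∀ s < t, ∀ b, MeasurableSet[I.preAct ℱ s] {ω | b ∈ I.explored s ω})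
    {π : X → Fin K} (hπ : Measurable π) :
    Measurable[ℱ t] fun ω => I.ipsEmp ε t ω π := by
  unfold ipsEmp empLoss
  refine Measurable.div_const (Finset.measurable_fun_sum _ fun s hs => ?_) _
  have hs' := Finset.mem_range.mp hs
  exact (h.measurable_ipsLoss_policy_of hP (hA s hs') hπ).mono (ℱ.mono hs') le_rfl

/-- Strong induction: the explored set of a round depends on past estimates, hence on earlier
explored sets. Finiteness of the class turns the random greedy policy and the existential over
policies into finite unions. -/
lemma measurableSet_explored (h : I.IsRun ℱ μ D P ε δ) (hP : ∀ π ∈ P, Measurable π) (t : ℕ) :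
    ∀ b, MeasurableSet[I.preAct ℱ t] {ω | b ∈ I.explored t ω} := by
  induction t using Nat.strong_induction_on with
  | _ t ih =>
    intro b
    rcases Nat.eq_zero_or_pos t with rfl | ht
    · simp [h.explored_zero]
    have hset : {ω | b ∈ I.explored t ω} = ⋃ π ∈ P, (fun ω => π (I.x t ω)) ⁻¹' {b} ∩
        ⋃ π' ∈ P, {ω | I.greedy t ω = π'} ∩
          {ω | I.ipsEmp ε t ω π - I.ipsEmp ε t ω π' ≤ threshold K P.card ε δ t} := by
      ext ω
      simp only [Set.mem_ofPred_eq, h.mem_explored t ht ω b, Set.mem_iUnion, Set.mem_inter_iff,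
        Set.mem_preimage, Set.mem_singleton_iff, exists_prop]
      constructor
      · rintro ⟨π, hπ, hb, hle⟩
        exact ⟨π, hπ, hb, _, h.greedy_mem t ω, rfl, hle⟩
      · rintro ⟨π, hπ, hb, π', -, rfl, hle⟩
        exact ⟨π, hπ, hb, hle⟩
    rw [hset]
    refine MeasurableSet.biUnion P.countable_toSet fun π hπ => ?_
    refine (measurable_policy_preAct I ℱ t (hP π hπ) (measurableSet_singleton b)).inter ?_
    refine le_preAct I ℱ t _ (MeasurableSet.biUnion P.countable_toSet fun π' hπ' => ?_)
    refine (h.measurable_greedy t π' hπ').inter ?_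
    exact measurableSet_le ((h.measurable_ipsEmp_of hP ih (hP π hπ)).sub
      (h.measurable_ipsEmp_of hP ih (hP π' hπ'))) measurable_const

lemma measurable_ipsIfPlayed (h : I.IsRun ℱ μ D P ε δ) (hP : ∀ π ∈ P, Measurable π) (t : ℕ)
    (a c : Fin K) : Measurable[I.preAct ℱ t] (I.ipsIfPlayed ε t a c) :=
  h.measurable_ipsIfPlayed_of hP (h.measurableSet_explored hP t) a c

lemma measurable_ipsLoss_policy (h : I.IsRun ℱ μ D P ε δ) (hP : ∀ π ∈ P, Measurable π) (t : ℕ)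
    {π : X → Fin K} (hπ : Measurable π) :
    Measurable[ℱ (t + 1)] fun ω => I.ipsLoss ε t ω (π (I.x t ω)) :=
  h.measurable_ipsLoss_policy_of hP (h.measurableSet_explored hP t) hπ

lemma measurable_loss_policy (I : Interaction X Ω K) (ℱ : Filtration ℕ mΩ) (t : ℕ)
    {π : X → Fin K} (hπ : Measurable π) :
    Measurable[I.preAct ℱ t] fun ω => I.loss t ω (π (I.x t ω)) :=
  measurable_eval_fin (F := fun c ω => I.loss t ω c) (measurable_loss_preAct I ℱ t)
    (measurable_policy_preAct I ℱ t hπ)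

lemma measurable_biasedLoss_policy (h : I.IsRun ℱ μ D P ε δ) (hP : ∀ π ∈ P, Measurable π) (t : ℕ)
    {π : X → Fin K} (hπ : Measurable π) :
    Measurable[I.preAct ℱ t] fun ω => I.biasedLoss t ω (π (I.x t ω)) :=
  measurable_eval_fin (F := fun c ω => I.biasedLoss t ω c)
    (fun c => Measurable.ite (h.measurableSet_explored hP t c) (measurable_loss_preAct I ℱ t c)
      measurable_const)
    (measurable_policy_preAct I ℱ t hπ)

/-- The greedy policy is its own witness because the threshold is nonnegative. This is what makes
`prob` a probability vector. -/
lemma greedy_mem_explored (h : I.IsRun ℱ μ D P ε δ) (hδ : 0 < δ) (hδ1 : δ < 1) (hε : 0 < ε)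
    (t : ℕ) (ω : Ω) : I.greedy t ω (I.x t ω) ∈ I.explored t ω := by
  rcases Nat.eq_zero_or_pos t with rfl | ht
  · simp [h.explored_zero]
  · rw [h.mem_explored t ht]
    refine ⟨_, h.greedy_mem t ω, rfl, ?_⟩
    rw [sub_self]
    exact threshold_nonneg (Finset.card_pos.mpr ⟨_, h.greedy_mem t ω⟩) hδ hδ1 hε t

end IsRun

end Interaction

namespace Interaction

/-! ### Conditional moments of one round -/

section Pointwise

variable {X Ω : Type*} {K : ℕ} {I : Interaction X Ω K} {ε : ℝ} {t : ℕ} {ω : Ω}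

lemma sum_prob (hg : I.greedy t ω (I.x t ω) ∈ I.explored t ω) : ∑ a, I.prob ε t ω a = 1 :=
  playProb_sum hg

lemma prob_nonneg (hε : 0 < ε) (hε1 : ε ≤ 1) (a : Fin K) : 0 ≤ I.prob ε t ω a :=
  playProb_nonneg hε.le hε1 a

lemma div_le_prob (hε : 0 < ε) (hε1 : ε ≤ 1) {a : Fin K} (ha : a ∈ I.explored t ω) :
    ε / K ≤ I.prob ε t ω a :=
  le_playProb hε.le hε1 ha

lemma div_pos_of_fin (hε : 0 < ε) (a : Fin K) : 0 < ε / K := by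
  have : (0 : ℝ) < K := by exact_mod_cast Fin.pos a
  positivity

lemma one_le_div_of_fin (hε : 0 < ε) (hε1 : ε ≤ 1) (a : Fin K) : 1 ≤ (K : ℝ) / ε := by
  have : (1 : ℝ) ≤ K := by exact_mod_cast Fin.pos a
  rw [le_div_iff₀ hε]; linarith

/-- For an explored action the weight `1 / p` cancels `p > 0`; for an unexplored one the estimate is
the constant 1 and the probabilities sum to 1. -/
lemma sum_prob_mul_ipsIfPlayed (hε : 0 < ε) (hε1 : ε ≤ 1)
    (hg : I.greedy t ω (I.x t ω) ∈ I.explored t ω) (c : Fin K) :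
    ∑ a, I.prob ε t ω a * I.ipsIfPlayed ε t a c ω = I.biasedLoss t ω c := by
  unfold ipsIfPlayed biasedLoss
  by_cases hc : c ∈ I.explored t ω
  · have hp := (div_pos_of_fin hε c).trans_le (div_le_prob hε hε1 hc)
    simp only [hc, if_true, mul_ite, mul_zero, Finset.sum_ite_eq, Finset.mem_univ]
    field_simp
  · simp [hc, sum_prob hg]

lemma sum_prob_mul_ipsIfPlayed_sq_le (hε : 0 < ε) (hε1 : ε ≤ 1)
    (hg : I.greedy t ω (I.x t ω) ∈ I.explored t ω)
    (hl : ∀ b, I.loss t ω b ∈ Set.Icc (0 : ℝ) 1) (c : Fin K) :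
    ∑ a, I.prob ε t ω a * I.ipsIfPlayed ε t a c ω ^ 2 ≤ K / ε := by
  unfold ipsIfPlayed
  by_cases hc : c ∈ I.explored t ω
  · have hp0 := div_pos_of_fin hε c
    have hp1 := div_le_prob (ε := ε) hε hε1 hc
    have hp := hp0.trans_le hp1
    simp only [hc, if_true, ite_pow, mul_ite, ne_eq, OfNat.ofNat_ne_zero, not_false_eq_true,
      zero_pow, mul_zero, Finset.sum_ite_eq, Finset.mem_univ]
    calc I.prob ε t ω c * (I.loss t ω c / I.prob ε t ω c) ^ 2
        = I.loss t ω c ^ 2 / I.prob ε t ω c := by field_simp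
      _ ≤ 1 / (ε / K) := by
          have := hl c
          exact div_le_div₀ zero_le_one (pow_le_one₀ this.1 this.2) hp0 hp1
      _ = K / ε := one_div_div _ _
  · simp only [hc, if_false, one_pow, mul_one, sum_prob hg]
    exact one_le_div_of_fin hε hε1 c

lemma ipsIfPlayed_mem_Icc (hε : 0 < ε) (hε1 : ε ≤ 1)
    (hl : ∀ b, I.loss t ω b ∈ Set.Icc (0 : ℝ) 1) (a c : Fin K) :
    I.ipsIfPlayed ε t a c ω ∈ Set.Icc (0 : ℝ) (K / ε) := by
  have hK := one_le_div_of_fin hε hε1 c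
  unfold ipsIfPlayed
  split_ifs with h1 h2
  · subst h2
    have hp0 := div_pos_of_fin hε c
    have hp1 := div_le_prob (ε := ε) hε hε1 h1
    refine ⟨div_nonneg (hl c).1 (hp0.le.trans hp1), ?_⟩
    rw [← one_div_div ε (K : ℝ)]
    exact div_le_div₀ zero_le_one (hl c).2 hp0 hp1
  · exact ⟨le_rfl, by linarith⟩
  · exact ⟨zero_le_one, hK⟩

lemma biasedLoss_mem_Icc (hl : ∀ b, I.loss t ω b ∈ Set.Icc (0 : ℝ) 1) (c : Fin K) :
    I.biasedLoss t ω c ∈ Set.Icc (0 : ℝ) 1 := by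
  unfold biasedLoss
  split_ifs
  · exact hl c
  · exact ⟨zero_le_one, le_rfl⟩

lemma loss_le_biasedLoss (hl : ∀ b, I.loss t ω b ∈ Set.Icc (0 : ℝ) 1) (c : Fin K) :
    I.loss t ω c ≤ I.biasedLoss t ω c := by
  unfold biasedLoss
  split_ifs
  · exact le_rfl
  · exact (hl c).2

lemma sq_sub_le_add_sq {u w : ℝ} (hu : 0 ≤ u) (hw : 0 ≤ w) : (u - w) ^ 2 ≤ u ^ 2 + w ^ 2 := by
  nlinarith [mul_nonneg hu hw]

/-- The variance is at most the second moment, and for nonnegative estimates the second moment of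
the difference is at most the sum of the two second moments, each at most `K / ε`. When the actions
coincide everything cancels; this is the source of ρ. -/
lemma sum_prob_mul_sq_sub_le (hε : 0 < ε) (hε1 : ε ≤ 1)
    (hg : I.greedy t ω (I.x t ω) ∈ I.explored t ω)
    (hl : ∀ b, I.loss t ω b ∈ Set.Icc (0 : ℝ) 1) (c c' : Fin K) :
    ∑ a, I.prob ε t ω a * (I.ipsIfPlayed ε t a c ω - I.ipsIfPlayed ε t a c' ω
        - (I.biasedLoss t ω c - I.biasedLoss t ω c')) ^ 2
      ≤ if c ≠ c' then 2 * K / ε else 0 := by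
  split_ifs with hcc
  swap
  · simp only [ne_eq, not_not] at hcc
    simp [hcc]
  set B := I.biasedLoss t ω c - I.biasedLoss t ω c' with hB
  have hmean : ∑ a, I.prob ε t ω a * (I.ipsIfPlayed ε t a c ω - I.ipsIfPlayed ε t a c' ω) = B := by
    simp only [mul_sub, Finset.sum_sub_distrib, sum_prob_mul_ipsIfPlayed hε hε1 hg, hB]
  have hexp : ∑ a, I.prob ε t ω a * (I.ipsIfPlayed ε t a c ω - I.ipsIfPlayed ε t a c' ω - B) ^ 2
      = ∑ a, I.prob ε t ω a * (I.ipsIfPlayed ε t a c ω - I.ipsIfPlayed ε t a c' ω) ^ 2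
        - 2 * B * ∑ a, I.prob ε t ω a * (I.ipsIfPlayed ε t a c ω - I.ipsIfPlayed ε t a c' ω)
        + B ^ 2 * ∑ a, I.prob ε t ω a := by
    rw [Finset.mul_sum, Finset.mul_sum, ← Finset.sum_sub_distrib, ← Finset.sum_add_distrib]
    exact Finset.sum_congr rfl fun a _ => by ring
  rw [hexp, hmean, sum_prob hg]
  have hsq : ∑ a, I.prob ε t ω a * (I.ipsIfPlayed ε t a c ω - I.ipsIfPlayed ε t a c' ω) ^ 2
      ≤ ∑ a, I.prob ε t ω a * I.ipsIfPlayed ε t a c ω ^ 2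
        + ∑ a, I.prob ε t ω a * I.ipsIfPlayed ε t a c' ω ^ 2 := by
    rw [← Finset.sum_add_distrib]
    refine Finset.sum_le_sum fun a _ => ?_
    rw [← mul_add]
    exact mul_le_mul_of_nonneg_left (sq_sub_le_add_sq (ipsIfPlayed_mem_Icc hε hε1 hl a c).1
      (ipsIfPlayed_mem_Icc hε hε1 hl a c').1) (prob_nonneg hε hε1 a)
  have h1 := sum_prob_mul_ipsIfPlayed_sq_le hε hε1 hg hl c
  have h2 := sum_prob_mul_ipsIfPlayed_sq_le hε hε1 hg hl c'
  have h3 : 2 * (K : ℝ) / ε = K / ε + K / ε := by ring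
  nlinarith [sq_nonneg B]

end Pointwise

variable {X Ω : Type*} {K : ℕ} [MeasurableSpace X] [mΩ : MeasurableSpace Ω]

namespace IsRun

variable {I : Interaction X Ω K} {ℱ : Filtration ℕ mΩ} {μ : Measure Ω}
  {D : Measure (X × (Fin K → ℝ))} {P : Finset (X → Fin K)} {ε δ : ℝ}

lemma ae_loss_mem_Icc (h : I.IsRun ℱ μ D P ε δ)
    (hD : ∀ᵐ z ∂D, ∀ b, z.2 b ∈ Set.Icc (0 : ℝ) 1) :
    ∀ᵐ ω ∂μ, ∀ t b, I.loss t ω b ∈ Set.Icc (0 : ℝ) 1 := by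
  refine ae_all_iff.mpr fun t => ?_
  rw [← h.law t] at hD
  exact ae_of_ae_map ((h.measurable_data t).mono (ℱ.le _) le_rfl).aemeasurable hD

/-- Averaging over the action of round `t`. -/
lemma condExp_act [IsProbabilityMeasure μ] (h : I.IsRun ℱ μ D P ε δ) {t : ℕ}
    {F : Fin K → Ω → ℝ} {C : ℝ} (hF : ∀ b, Measurable[I.preAct ℱ t] (F b))
    (hC : ∀ᵐ ω ∂μ, ∀ b, |F b ω| ≤ C) :
    μ[fun ω => F (I.act t ω) ω | I.preAct ℱ t] =ᵐ[μ] fun ω => ∑ b, I.prob ε t ω b * F b ω := by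
  -- Splitting by the value of the action leaves coefficients `F b` known before the draw; only the
  -- indicators are averaged, by `act_law`.
  have hsum : (fun ω => F (I.act t ω) ω)
      = ∑ b, F b * {ω | I.act t ω = b}.indicator (fun _ => (1 : ℝ)) := by
    ext ω
    simp [Set.indicator_apply]
  have hact : Measurable (I.act t) := (h.measurable_act t).mono (ℱ.le _) le_rfl
  have hset : ∀ b, MeasurableSet {ω | I.act t ω = b} := fun b =>
    hact (measurableSet_singleton b)
  have hFi : ∀ b, Integrable (F b) μ := fun b =>
    integrable_of_ae_abs_le ((hF b).mono (h.preAct_le t) le_rfl)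
      (hC.mono fun ω hω => hω b)
  have hind : ∀ b, Integrable ({ω | I.act t ω = b}.indicator (fun _ => (1 : ℝ))) μ := fun b =>
    (integrable_const _).indicator (hset b)
  have hprod : ∀ b, Integrable (F b * {ω | I.act t ω = b}.indicator (fun _ => (1 : ℝ))) μ := by
    intro b
    have : F b * {ω | I.act t ω = b}.indicator (fun _ => (1 : ℝ))
        = {ω | I.act t ω = b}.indicator (F b) := by
      ext ω
      simp [Set.indicator_apply]
    rw [this]
    exact (hFi b).indicator (hset b)
  have hpull : ∀ b, μ[F b * {ω | I.act t ω = b}.indicator (fun _ => (1 : ℝ)) | I.preAct ℱ t]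
      =ᵐ[μ] F b * μ[{ω | I.act t ω = b}.indicator (fun _ => (1 : ℝ)) | I.preAct ℱ t] := fun b =>
    condExp_mul_of_stronglyMeasurable_left (hF b).stronglyMeasurable (hprod b) (hind b)
  rw [hsum]
  filter_upwards [condExp_finsetSum (fun b (_ : b ∈ Finset.univ) => hprod b) (I.preAct ℱ t),
    ae_all_iff.mpr hpull, ae_all_iff.mpr fun b => h.act_law t b] with ω h1 h2 h3
  rw [h1, Finset.sum_apply]
  refine Finset.sum_congr rfl fun b _ => ?_
  rw [h2 b, Pi.mul_apply, h3 b, mul_comm]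

lemma integral_data (h : I.IsRun ℱ μ D P ε δ) (t : ℕ) {f : X × (Fin K → ℝ) → ℝ}
    (hf : Measurable f) : ∫ ω, f (I.x t ω, I.loss t ω) ∂μ = ∫ z, f z ∂D := by
  rw [← h.law t, integral_map ((h.measurable_data t).mono (ℱ.le _) le_rfl).aemeasurable
    hf.aestronglyMeasurable]

/-- The data of round `t` are independent of the past. -/
lemma condExp_data [IsProbabilityMeasure μ] (h : I.IsRun ℱ μ D P ε δ) (t : ℕ)
    {f : X × (Fin K → ℝ) → ℝ} (hf : Measurable f) :
    μ[fun ω => f (I.x t ω, I.loss t ω) | ℱ t] =ᵐ[μ] fun _ => ∫ z, f z ∂D := by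
  rw [← h.integral_data t hf]
  exact condExp_indep_eq ((h.measurable_data t).mono (ℱ.le _) le_rfl).comap_le (ℱ.le t)
    (hf.comp (comap_measurable _)).stronglyMeasurable (h.indep t)

lemma measurable_policy_loss {π : X → Fin K} (hπ : Measurable π) :
    Measurable fun z : X × (Fin K → ℝ) => z.2 (π z.1) :=
  measurable_eval_fin (F := fun c (z : X × (Fin K → ℝ)) => z.2 c)
    (fun c => (measurable_pi_apply c).comp measurable_snd) (hπ.comp measurable_fst)

end IsRun

end Interaction

namespace Interaction

variable {X Ω : Type*} {K : ℕ}

/-! ### The deviation event -/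

/-- The error of the estimated loss difference between `π` and `π'` in round `t`. -/
noncomputable def ipsDeviation (I : Interaction X Ω K) (ε : ℝ) (π π' : X → Fin K) (t : ℕ)
    (ω : Ω) : ℝ :=
  I.ipsLoss ε t ω (π (I.x t ω)) - I.ipsLoss ε t ω (π' (I.x t ω))
    - (I.biasedLoss t ω (π (I.x t ω)) - I.biasedLoss t ω (π' (I.x t ω)))

/-- The deviation of the loss difference between `π` and `π'` in round `t` from its mean. -/
noncomputable def lossDeviation [MeasurableSpace X] (I : Interaction X Ω K)
    (D : Measure (X × (Fin K → ℝ)))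
    (π π' : X → Fin K) (t : ℕ) (ω : Ω) : ℝ :=
  I.loss t ω (π (I.x t ω)) - I.loss t ω (π' (I.x t ω)) - (expLoss D π - expLoss D π')

/-- The value of `ipsDeviation` that results from playing `a` in round `t`. -/
noncomputable def ipsDeviationIfPlayed (I : Interaction X Ω K) (ε : ℝ) (π π' : X → Fin K) (t : ℕ)
    (a : Fin K) (ω : Ω) : ℝ :=
  I.ipsIfPlayed ε t a (π (I.x t ω)) ω - I.ipsIfPlayed ε t a (π' (I.x t ω)) ω
    - (I.biasedLoss t ω (π (I.x t ω)) - I.biasedLoss t ω (π' (I.x t ω)))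

lemma sum_ipsDeviation_div (I : Interaction X Ω K) (ε : ℝ) (π π' : X → Fin K) (T : ℕ) (ω : Ω) :
    (∑ t ∈ Finset.range T, I.ipsDeviation ε π π' t ω) / T
      = (I.ipsEmp ε T ω π - I.ipsEmp ε T ω π') - (I.biasedEmp T ω π - I.biasedEmp T ω π') := by
  simp only [ipsDeviation, ipsEmp, biasedEmp, empLoss, Finset.sum_sub_distrib, sub_div]

lemma sum_lossDeviation_div [MeasurableSpace X] (I : Interaction X Ω K)
    (D : Measure (X × (Fin K → ℝ)))
    (π π' : X → Fin K) {T : ℕ} (hT : 1 ≤ T) (ω : Ω) :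
    (∑ t ∈ Finset.range T, I.lossDeviation D π π' t ω) / T
      = (I.trueEmp T ω π - I.trueEmp T ω π') - (expLoss D π - expLoss D π') := by
  have hT0 : (T : ℝ) ≠ 0 := by positivity
  simp only [lossDeviation, trueEmp, empLoss, Finset.sum_sub_distrib, Finset.sum_const,
    Finset.card_range, nsmul_eq_mul]
  field_simp

namespace IsRun

variable [MeasurableSpace X] [mΩ : MeasurableSpace Ω]

variable {I : Interaction X Ω K} {ℱ : Filtration ℕ mΩ} {μ : Measure Ω}
  {D : Measure (X × (Fin K → ℝ))} {P : Finset (X → Fin K)} {ε δ : ℝ} {π π' : X → Fin K}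

lemma measurable_ipsDeviation (h : I.IsRun ℱ μ D P ε δ) (hP : ∀ π ∈ P, Measurable π)
    (hπ : Measurable π) (hπ' : Measurable π') (t : ℕ) :
    Measurable[ℱ (t + 1)] (I.ipsDeviation ε π π' t) :=
  ((h.measurable_ipsLoss_policy hP t hπ).sub (h.measurable_ipsLoss_policy hP t hπ')).sub
    (((h.measurable_biasedLoss_policy hP t hπ).sub
      (h.measurable_biasedLoss_policy hP t hπ')).mono (h.preAct_le_succ t) le_rfl)

lemma measurable_lossDeviation (h : I.IsRun ℱ μ D P ε δ) (hπ : Measurable π)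
    (hπ' : Measurable π') (t : ℕ) : Measurable[ℱ (t + 1)] (I.lossDeviation D π π' t) :=
  (((measurable_loss_policy I ℱ t hπ).sub
    (measurable_loss_policy I ℱ t hπ')).mono (h.preAct_le_succ t) le_rfl).sub measurable_const

lemma measurableSet_disagree (hπ : Measurable π) (hπ' : Measurable π') :
    MeasurableSet {z : X × (Fin K → ℝ) | π z.1 ≠ π' z.1} :=
  (measurableSet_eq_fun (hπ.comp measurable_fst) (hπ'.comp measurable_fst)).compl

lemma measurable_ipsDeviationIfPlayed (h : I.IsRun ℱ μ D P ε δ) (hP : ∀ π ∈ P, Measurable π)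
    (hπ : Measurable π) (hπ' : Measurable π') (t : ℕ) (a : Fin K) :
    Measurable[I.preAct ℱ t] (I.ipsDeviationIfPlayed ε π π' t a) := by
  have hips : ∀ {π : X → Fin K}, Measurable π →
      Measurable[I.preAct ℱ t] fun ω => I.ipsIfPlayed ε t a (π (I.x t ω)) ω := fun hπ =>
    measurable_eval_fin (h.measurable_ipsIfPlayed hP t a) (measurable_policy_preAct I ℱ t hπ)
  exact ((hips hπ).sub (hips hπ')).sub
    ((h.measurable_biasedLoss_policy hP t hπ).sub (h.measurable_biasedLoss_policy hP t hπ'))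

lemma ae_abs_ipsDeviationIfPlayed_le (h : I.IsRun ℱ μ D P ε δ)
    (hD : ∀ᵐ z ∂D, ∀ b, z.2 b ∈ Set.Icc (0 : ℝ) 1) (hε : 0 < ε) (hε1 : ε ≤ 1) (t : ℕ) :
    ∀ᵐ ω ∂μ, ∀ a, |I.ipsDeviationIfPlayed ε π π' t a ω| ≤ K / ε + 1 := by
  filter_upwards [h.ae_loss_mem_Icc hD] with ω hl a
  have h1 := ipsIfPlayed_mem_Icc hε hε1 (hl t) a (π (I.x t ω))
  have h2 := ipsIfPlayed_mem_Icc hε hε1 (hl t) a (π' (I.x t ω))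
  have h3 := biasedLoss_mem_Icc (hl t) (π (I.x t ω))
  have h4 := biasedLoss_mem_Icc (hl t) (π' (I.x t ω))
  unfold ipsDeviationIfPlayed
  rw [abs_le]
  constructor <;> linarith [h1.1, h1.2, h2.1, h2.2, h3.1, h3.2, h4.1, h4.2]

lemma condExp_ipsDeviation [IsProbabilityMeasure μ] (h : I.IsRun ℱ μ D P ε δ)
    (hP : ∀ π ∈ P, Measurable π)
    (hD : ∀ᵐ z ∂D, ∀ b, z.2 b ∈ Set.Icc (0 : ℝ) 1) (hδ : 0 < δ) (hδ1 : δ < 1)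
    (hε : 0 < ε) (hε1 : ε ≤ 1) (hπ : Measurable π) (hπ' : Measurable π') (t : ℕ) :
    μ[I.ipsDeviation ε π π' t | ℱ t] =ᵐ[μ] 0 := by
  have h1 : μ[I.ipsDeviation ε π π' t | I.preAct ℱ t] =ᵐ[μ] 0 := by
    refine (h.condExp_act (F := fun a => I.ipsDeviationIfPlayed ε π π' t a)
      (h.measurable_ipsDeviationIfPlayed hP hπ hπ' t)
      (h.ae_abs_ipsDeviationIfPlayed_le hD hε hε1 t)).trans (.of_forall fun ω => ?_)
    have hg := h.greedy_mem_explored hδ hδ1 hε t ω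
    simp only [ipsDeviationIfPlayed, mul_sub, Finset.sum_sub_distrib,
      sum_prob_mul_ipsIfPlayed hε hε1 hg, ← Finset.sum_mul, sum_prob hg, Pi.zero_apply]
    ring
  refine (condExp_condExp_of_le (le_preAct I ℱ t) (h.preAct_le t)).symm.trans ?_
  refine (condExp_congr_ae h1).trans ?_
  rw [condExp_zero]

/-- Conditioning in two stages: averaging over the action leaves `2 * K / ε` times the indicator of
disagreement, and averaging over the independent context turns the indicator into ρ. -/
lemma condExp_ipsDeviation_sq_le [IsProbabilityMeasure μ] (h : I.IsRun ℱ μ D P ε δ)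
    (hP : ∀ π ∈ P, Measurable π)
    (hD : ∀ᵐ z ∂D, ∀ b, z.2 b ∈ Set.Icc (0 : ℝ) 1) (hδ : 0 < δ) (hδ1 : δ < 1)
    (hε : 0 < ε) (hε1 : ε ≤ 1) (hπ : Measurable π) (hπ' : Measurable π') (t : ℕ) :
    μ[fun ω => I.ipsDeviation ε π π' t ω ^ 2 | ℱ t]
      ≤ᵐ[μ] fun _ => 2 * K * disagreement D π π' / ε := by
  set f : X × (Fin K → ℝ) → ℝ :=
    {z | π z.1 ≠ π' z.1}.indicator (fun _ => 2 * (K : ℝ) / ε) with hf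
  have hfm : Measurable f := measurable_const.indicator (measurableSet_disagree hπ hπ')
  have hfi : ∫ z, f z ∂D = 2 * K * disagreement D π π' / ε := by
    rw [hf, integral_indicator_const _ (measurableSet_disagree hπ hπ'), disagreement, smul_eq_mul]
    ring
  have hact := h.condExp_act (t := t) (C := (K / ε + 1) ^ 2)
    (F := fun a ω => I.ipsDeviationIfPlayed ε π π' t a ω ^ 2)
    (fun a => (h.measurable_ipsDeviationIfPlayed hP hπ hπ' t a).pow_const 2) (by
      filter_upwards [h.ae_abs_ipsDeviationIfPlayed_le (π := π) (π' := π') hD hε hε1 t] with ω hω a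
      rw [abs_pow]
      exact pow_le_pow_left₀ (abs_nonneg _) (hω a) 2)
  have h1 : μ[fun ω => I.ipsDeviation ε π π' t ω ^ 2 | I.preAct ℱ t]
      ≤ᵐ[μ] fun ω => f (I.x t ω, I.loss t ω) := by
    filter_upwards [hact, h.ae_loss_mem_Icc hD] with ω h2 hl
    have h3 : (μ[fun ω => I.ipsDeviation ε π π' t ω ^ 2 | I.preAct ℱ t]) ω = _ := h2
    rw [h3]
    refine (sum_prob_mul_sq_sub_le hε hε1 (h.greedy_mem_explored hδ hδ1 hε t ω) (hl t)
      (π (I.x t ω)) (π' (I.x t ω))).trans (le_of_eq ?_)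
    simp only [hf, Set.indicator_apply, Set.mem_ofPred_eq]
  have hbd : ∀ z, |f z| ≤ 2 * K / ε := by
    intro z
    have : 0 ≤ 2 * (K : ℝ) / ε := by positivity
    rw [hf, Set.indicator_apply]
    split_ifs
    · rw [abs_of_nonneg this]
    · simpa using this
  have hint : Integrable (fun ω => f (I.x t ω, I.loss t ω)) μ :=
    integrable_of_ae_abs_le (hfm.comp ((h.measurable_data t).mono (ℱ.le _) le_rfl))
      (.of_forall fun ω => hbd _)
  have h2 := condExp_mono (m := ℱ t) integrable_condExp hint h1
  filter_upwards [h2, h.condExp_data t hfm, condExp_condExp_of_le (μ := μ)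
    (f := fun ω => I.ipsDeviation ε π π' t ω ^ 2) (le_preAct I ℱ t) (h.preAct_le t)]
    with ω h3 h4 h5
  rw [h5, h4, hfi] at h3
  exact h3

lemma ae_abs_ipsDeviation_le (h : I.IsRun ℱ μ D P ε δ)
    (hD : ∀ᵐ z ∂D, ∀ b, z.2 b ∈ Set.Icc (0 : ℝ) 1) (hε : 0 < ε) (hε1 : ε ≤ 1) (t : ℕ) :
    ∀ᵐ ω ∂μ, |I.ipsDeviation ε π π' t ω| ≤ K / ε + 1 :=
  (h.ae_abs_ipsDeviationIfPlayed_le hD hε hε1 t).mono fun ω hω => hω (I.act t ω)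

lemma integrable_policy_loss [IsProbabilityMeasure D]
    (hD : ∀ᵐ z ∂D, ∀ b, z.2 b ∈ Set.Icc (0 : ℝ) 1) (hπ : Measurable π) :
    Integrable (fun z : X × (Fin K → ℝ) => z.2 (π z.1)) D := by
  refine integrable_of_ae_abs_le (R := 1) (measurable_policy_loss hπ) ?_
  filter_upwards [hD] with z hz
  rw [abs_of_nonneg (hz _).1]
  exact (hz _).2

lemma expLoss_mem_Icc [IsProbabilityMeasure D]
    (hD : ∀ᵐ z ∂D, ∀ b, z.2 b ∈ Set.Icc (0 : ℝ) 1) (hπ : Measurable π) :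
    expLoss D π ∈ Set.Icc (0 : ℝ) 1 := by
  constructor
  · exact integral_nonneg_of_ae (hD.mono fun z hz => (hz _).1)
  · have := integral_mono_ae (integrable_policy_loss hD hπ) (integrable_const (1 : ℝ))
      (hD.mono fun z hz => (hz (π z.1)).2)
    simpa [expLoss] using this

lemma ae_abs_lossDeviation_le [IsProbabilityMeasure D] (h : I.IsRun ℱ μ D P ε δ)
    (hD : ∀ᵐ z ∂D, ∀ b, z.2 b ∈ Set.Icc (0 : ℝ) 1) (hπ : Measurable π) (hπ' : Measurable π')
    (t : ℕ) : ∀ᵐ ω ∂μ, |I.lossDeviation D π π' t ω| ≤ 2 := by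
  filter_upwards [h.ae_loss_mem_Icc hD] with ω hl
  have h1 := hl t (π (I.x t ω))
  have h2 := hl t (π' (I.x t ω))
  have h3 := expLoss_mem_Icc hD hπ
  have h4 := expLoss_mem_Icc hD hπ'
  unfold lossDeviation
  rw [abs_le]
  constructor <;> linarith [h1.1, h1.2, h2.1, h2.2, h3.1, h3.2, h4.1, h4.2]

lemma condExp_lossDeviation [IsProbabilityMeasure μ] [IsProbabilityMeasure D]
    (h : I.IsRun ℱ μ D P ε δ)
    (hD : ∀ᵐ z ∂D, ∀ b, z.2 b ∈ Set.Icc (0 : ℝ) 1) (hπ : Measurable π) (hπ' : Measurable π')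
    (t : ℕ) : μ[I.lossDeviation D π π' t | ℱ t] =ᵐ[μ] 0 := by
  refine (h.condExp_data t (f := fun z => z.2 (π z.1) - z.2 (π' z.1)
    - (expLoss D π - expLoss D π')) (((measurable_policy_loss hπ).sub
      (measurable_policy_loss hπ')).sub measurable_const)).trans (.of_forall fun ω => ?_)
  have hi := integrable_policy_loss hD hπ
  have hi' := integrable_policy_loss hD hπ'
  have hd : Integrable (fun z : X × (Fin K → ℝ) => z.2 (π z.1) - z.2 (π' z.1)) D := hi.sub hi'
  beta_reduce
  rw [integral_sub hd (integrable_const _), integral_sub hi hi']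
  simp [expLoss]

/-- The variance is the second moment minus `m ^ 2`, and the squared loss difference is at most the
indicator of disagreement. -/
lemma condExp_lossDeviation_sq_le [IsProbabilityMeasure μ] [IsProbabilityMeasure D]
    (h : I.IsRun ℱ μ D P ε δ)
    (hD : ∀ᵐ z ∂D, ∀ b, z.2 b ∈ Set.Icc (0 : ℝ) 1) (hπ : Measurable π) (hπ' : Measurable π')
    (t : ℕ) : μ[fun ω => I.lossDeviation D π π' t ω ^ 2 | ℱ t]
      ≤ᵐ[μ] fun _ => disagreement D π π' := by
  refine (h.condExp_data t (f := fun z => (z.2 (π z.1) - z.2 (π' z.1)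
    - (expLoss D π - expLoss D π')) ^ 2) ((((measurable_policy_loss hπ).sub
      (measurable_policy_loss hπ')).sub measurable_const).pow_const 2)).le.trans
      (.of_forall fun ω => ?_)
  have hi := integrable_policy_loss hD hπ
  have hi' := integrable_policy_loss hD hπ'
  have hm : ∫ z, (z.2 (π z.1) - z.2 (π' z.1)) ∂D = expLoss D π - expLoss D π' :=
    integral_sub hi hi'
  set m := expLoss D π - expLoss D π'
  have hlin : Integrable (fun z : X × (Fin K → ℝ) => (-2 * m) * (z.2 (π z.1) - z.2 (π' z.1))) D :=
    (hi.sub hi').const_mul _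
  have haff : Integrable
      (fun z : X × (Fin K → ℝ) => (-2 * m) * (z.2 (π z.1) - z.2 (π' z.1)) + m ^ 2) D :=
    hlin.add (integrable_const _)
  have hset := measurableSet_disagree hπ hπ'
  have hind : Integrable ({z : X × (Fin K → ℝ) | π z.1 ≠ π' z.1}.indicator
      (fun _ => (1 : ℝ))) D := (integrable_const _).indicator hset
  calc ∫ z, (z.2 (π z.1) - z.2 (π' z.1) - m) ^ 2 ∂D
      ≤ ∫ z, ({z : X × (Fin K → ℝ) | π z.1 ≠ π' z.1}.indicator (fun _ => (1 : ℝ)) z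
          + ((-2 * m) * (z.2 (π z.1) - z.2 (π' z.1)) + m ^ 2)) ∂D := by
        refine integral_mono_of_nonneg (.of_forall fun z => sq_nonneg _)
          (hind.add haff) ?_
        filter_upwards [hD] with z hz
        have : (z.2 (π z.1) - z.2 (π' z.1)) ^ 2
            ≤ {z : X × (Fin K → ℝ) | π z.1 ≠ π' z.1}.indicator (fun _ => (1 : ℝ)) z := by
          rw [Set.indicator_apply]
          split_ifs with hne
          · have h1 := hz (π z.1)
            have h2 := hz (π' z.1)
            rw [← sq_abs]
            refine pow_le_one₀ (abs_nonneg _) (abs_le.mpr ⟨?_, ?_⟩)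
              <;> linarith [h1.1, h1.2, h2.1, h2.2]
          · simp only [Set.mem_ofPred_eq, ne_eq, not_not] at hne
            simp [hne]
        nlinarith
    _ = disagreement D π π' - m ^ 2 := by
        rw [integral_add hind haff, integral_add hlin (integrable_const _), integral_const_mul,
          hm, integral_indicator_const _ hset]
        simp [disagreement]
        ring
    _ ≤ disagreement D π π' := by linarith [sq_nonneg m]

end IsRun

end Interaction

/-- The probability budget of horizon `n + 1`. -/
lemma hasSum_budget (δ : ℝ) :
    HasSum (fun n : ℕ => δ / 2 / (((n + 1 : ℕ) : ℝ) ^ 2 + (n + 1 : ℕ))) (δ / 2) := by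
  -- Telescoping, from `1 / (m ^ 2 + m) = 1 / m - 1 / (m + 1)`.
  have h1 : ∀ n : ℕ, ∑ i ∈ Finset.range n, δ / 2 / (((i + 1 : ℕ) : ℝ) ^ 2 + (i + 1 : ℕ))
      = δ / 2 - δ / 2 * (1 / ((n : ℝ) + 1)) := by
    intro n
    induction n with
    | zero => simp
    | succ n ih =>
      rw [Finset.sum_range_succ, ih]
      push_cast
      field_simp
      ring
  have h2 : Filter.Tendsto (fun n : ℕ => δ / 2 - δ / 2 * (1 / ((n : ℝ) + 1))) Filter.atTop
      (nhds (δ / 2)) := by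
    simpa using (tendsto_one_div_add_atTop_nhds_zero_nat (𝕜 := ℝ)).const_mul (δ / 2)
      |>.const_sub (δ / 2)
  have hs : Summable fun n : ℕ => 1 / (((n + 1 : ℕ) : ℝ) ^ 2) :=
    (summable_nat_add_iff (f := fun n : ℕ => 1 / ((n : ℝ) ^ 2)) 1).mpr
      (Real.summable_one_div_nat_pow.mpr one_lt_two)
  have hsum : Summable fun n : ℕ => δ / 2 / (((n + 1 : ℕ) : ℝ) ^ 2 + (n + 1 : ℕ)) := by
    refine Summable.of_norm_bounded (hs.mul_left |δ / 2|) fun n => ?_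
    rw [norm_div, Real.norm_eq_abs, Real.norm_of_nonneg (by positivity), mul_one_div]
    gcongr
    linarith [Nat.cast_nonneg (α := ℝ) (n + 1)]
  rw [hsum.hasSum_iff_tendsto_nat]
  simpa only [h1] using h2

lemma exp_neg_two_mul_confTerm {N : ℕ} {δ : ℝ} (hN : 1 ≤ N) (hδ : 0 < δ) {T : ℕ} (hT : 1 ≤ T) :
    Real.exp (-(2 * (T * confTerm N δ T))) = (δ / ((T : ℝ) ^ 2 + T) / (2 * N)) ^ 2 := by
  have hT0 : (0 : ℝ) < T := by exact_mod_cast hT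
  have hN0 : (0 : ℝ) < N := by exact_mod_cast hN
  rw [confTerm, mul_div_cancel₀ _ hT0.ne', ← mul_neg, ← Real.log_inv, inv_div,
    show ∀ y : ℝ, 2 * y = y + y from two_mul, Real.exp_add, Real.exp_log (by positivity)]
  ring

/-! ### Probability of the deviation event -/

namespace Interaction.IsRun

variable {X Ω : Type*} {K : ℕ} [MeasurableSpace X]

/-- A countable union of failure events, suited to both measurability and the union bound. Horizons
are written `n + 1` because the event imposes nothing at `T = 0`. -/
lemma deviationEvent_eq_compl (I : Interaction X Ω K) (D : Measure (X × (Fin K → ℝ)))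
    (P : Finset (X → Fin K)) (πstar : X → Fin K) (ε δ : ℝ) :
    I.deviationEvent D P πstar ε δ = (⋃ n : ℕ, ⋃ π ∈ P,
      ({ω | 2 * √(2 * K * disagreement D π πstar / ε * confTerm P.card δ (n + 1))
          + (K / ε + 1) * confTerm P.card δ (n + 1)
          < |(∑ t ∈ Finset.range (n + 1), I.ipsDeviation ε π πstar t ω) / (n + 1 : ℕ)|}
        ∪ {ω | 2 * √(disagreement D π πstar * confTerm P.card δ (n + 1))
          + 2 * confTerm P.card δ (n + 1)
          < |(∑ t ∈ Finset.range (n + 1), I.lossDeviation D π πstar t ω) / (n + 1 : ℕ)|}))ᶜ := by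
  ext ω
  simp only [Set.mem_compl_iff, Set.mem_iUnion, Set.mem_union, Set.mem_ofPred_eq, not_exists,
    not_or, not_lt, sum_ipsDeviation_div, sum_lossDeviation_div I D _ _ (Nat.le_add_left 1 _),
    deviationEvent]
  have hcomm : ∀ (π : X → Fin K) (T : ℕ),
      2 * (K : ℝ) * disagreement D π πstar * confTerm P.card δ T / ε
        = 2 * K * disagreement D π πstar / ε * confTerm P.card δ T := fun π T => by ring
  simp only [hcomm]
  constructor
  · intro h n π hπ
    exact h π hπ (n + 1) (Nat.le_add_left 1 n)
  · intro h π hπ T hT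
    obtain ⟨n, rfl⟩ : ∃ n, T = n + 1 := ⟨T - 1, by omega⟩
    exact h n π hπ

variable [mΩ : MeasurableSpace Ω] {I : Interaction X Ω K} {ℱ : Filtration ℕ mΩ} {μ : Measure Ω}
  {D : Measure (X × (Fin K → ℝ))} {P : Finset (X → Fin K)} {ε δ : ℝ} {πstar : X → Fin K}

lemma measurableSet_deviationEvent (h : I.IsRun ℱ μ D P ε δ) (hP : ∀ π ∈ P, Measurable π)
    (hstar : πstar ∈ P) : MeasurableSet (I.deviationEvent D P πstar ε δ) := by
  rw [deviationEvent_eq_compl]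
  refine (MeasurableSet.iUnion fun n =>
    MeasurableSet.biUnion P.countable_toSet fun π hπ => ?_).compl
  have h1 : Measurable fun ω => ∑ t ∈ Finset.range (n + 1), I.ipsDeviation ε π πstar t ω :=
    (measurable_sum_range (h.measurable_ipsDeviation hP (hP π hπ) (hP _ hstar)) (n + 1)).mono
      (ℱ.le _) le_rfl
  have h2 : Measurable fun ω => ∑ t ∈ Finset.range (n + 1), I.lossDeviation D π πstar t ω :=
    (measurable_sum_range (h.measurable_lossDeviation (hP π hπ) (hP _ hstar)) (n + 1)).mono
      (ℱ.le _) le_rfl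
  refine MeasurableSet.union (measurableSet_lt measurable_const ?_)
    (measurableSet_lt measurable_const ?_)
  · exact (h1.div_const _).abs
  · exact (h2.div_const _).abs

/-- The gain of `δ / 2` over `δ` is essential: it keeps the probability of the event above 1/2 even
as δ approaches 1, so conditional expectations do not blow up. -/
theorem one_sub_le_measureReal_deviationEvent [IsProbabilityMeasure μ] [IsProbabilityMeasure D]
    (h : I.IsRun ℱ μ D P ε δ) (hP : ∀ π ∈ P, Measurable π)
    (hD : ∀ᵐ z ∂D, ∀ b, z.2 b ∈ Set.Icc (0 : ℝ) 1) (hδ : 0 < δ) (hδ1 : δ < 1)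
    (hε : 0 < ε) (hε1 : ε ≤ 1) (hstar : πstar ∈ P) :
    1 - δ / 2 ≤ μ.real (I.deviationEvent D P πstar ε δ) := by
  have hN : 1 ≤ P.card := Finset.card_pos.mpr ⟨_, hstar⟩
  have hN1 : (1 : ℝ) ≤ P.card := by exact_mod_cast hN
  have hmeas := h.measurableSet_deviationEvent hP hstar
  suffices hcompl : μ.real (I.deviationEvent D P πstar ε δ)ᶜ ≤ δ / 2 by
    rw [probReal_compl_eq_one_sub hmeas] at hcompl
    linarith
  rw [deviationEvent_eq_compl, compl_compl]
  set B : ℕ → (X → Fin K) → Set Ω := fun n π =>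
    ({ω | 2 * √(2 * K * disagreement D π πstar / ε * confTerm P.card δ (n + 1))
          + (K / ε + 1) * confTerm P.card δ (n + 1)
          < |(∑ t ∈ Finset.range (n + 1), I.ipsDeviation ε π πstar t ω) / (n + 1 : ℕ)|}
        ∪ {ω | 2 * √(disagreement D π πstar * confTerm P.card δ (n + 1))
          + 2 * confTerm P.card δ (n + 1)
          < |(∑ t ∈ Finset.range (n + 1), I.lossDeviation D π πstar t ω) / (n + 1 : ℕ)|}) with hB
  have hBle : ∀ n, ∀ π ∈ P, μ.real (B n π)
      ≤ 4 * (δ / (((n + 1 : ℕ) : ℝ) ^ 2 + (n + 1 : ℕ)) / (2 * P.card)) ^ 2 := by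
    intro n π hπ
    have he := confTerm_nonneg hN hδ hδ1 (n + 1)
    have hn : 1 ≤ n + 1 := Nat.le_add_left 1 n
    have hρ : 0 ≤ disagreement D π πstar := measureReal_nonneg
    have hm := hP π hπ
    have hm' := hP _ hstar
    have h1 := measure_abs_average_gt_le (h.measurable_ipsDeviation hP hm hm')
      (h.ae_abs_ipsDeviation_le hD hε hε1) (h.condExp_ipsDeviation hP hD hδ hδ1 hε hε1 hm hm')
      (h.condExp_ipsDeviation_sq_le hP hD hδ hδ1 hε hε1 hm hm') (by positivity) (by positivity)
      he hn
    have h2 := measure_abs_average_gt_le (h.measurable_lossDeviation hm hm')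
      (h.ae_abs_lossDeviation_le hD hm hm') (h.condExp_lossDeviation hD hm hm')
      (h.condExp_lossDeviation_sq_le hD hm hm') hρ two_pos he hn
    rw [exp_neg_two_mul_confTerm hN hδ hn] at h1 h2
    exact (measureReal_union_le _ _).trans (by linarith)
  have hround : ∀ n, μ (⋃ π ∈ P, B n π)
      ≤ ENNReal.ofReal (δ / 2 / (((n + 1 : ℕ) : ℝ) ^ 2 + (n + 1 : ℕ))) := by
    intro n
    rw [ENNReal.le_ofReal_iff_toReal_le (measure_ne_top _ _) (by positivity)]
    have hy : (2 : ℝ) ≤ ((n + 1 : ℕ) : ℝ) ^ 2 + (n + 1 : ℕ) := by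
      push_cast; nlinarith [Nat.cast_nonneg (α := ℝ) n]
    set y := ((n + 1 : ℕ) : ℝ) ^ 2 + (n + 1 : ℕ)
    -- Four tails per policy, each at most `(δ_T / (2N)) ^ 2`, sum to `δ_T ^ 2 / N`. Since `T ^ 2 +
    -- T ≥ 2`, one factor `δ_T` is at most 1/2.
    calc μ.real (⋃ π ∈ P, B n π) ≤ ∑ π ∈ P, μ.real (B n π) :=
          measureReal_biUnion_finset_le _ _
      _ ≤ ∑ _π ∈ P, 4 * (δ / y / (2 * P.card)) ^ 2 := Finset.sum_le_sum fun π hπ => hBle n π hπ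
      _ = (δ / y) * (δ / y) / P.card := by
          rw [Finset.sum_const, nsmul_eq_mul]; field_simp; ring
      _ ≤ (δ / y) * (δ / y) := div_le_self (by positivity) hN1
      _ ≤ (δ / y) * (1 / 2) := by
          have : δ / y ≤ 1 / 2 := div_le_div₀ zero_le_one hδ1.le two_pos hy
          exact mul_le_mul_of_nonneg_left this (by positivity)
      _ = δ / 2 / y := by ring
  have hsum := hasSum_budget δ
  refine ENNReal.toReal_le_of_le_ofReal (by positivity) ?_
  calc μ (⋃ n, ⋃ π ∈ P, B n π) ≤ ∑' n, μ (⋃ π ∈ P, B n π) := measure_iUnion_le _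
    _ ≤ ∑' n : ℕ, ENNReal.ofReal (δ / 2 / (((n + 1 : ℕ) : ℝ) ^ 2 + (n + 1 : ℕ))) :=
        ENNReal.tsum_le_tsum hround
    _ = ENNReal.ofReal (δ / 2) := by
        rw [← ENNReal.ofReal_tsum_of_nonneg (fun n => by positivity) hsum.summable, hsum.tsum_eq]

end Interaction.IsRun

/-! ### Consequences of the deviation event -/

/-- The threshold is the sum of the two deviation radii at the worst case `ρ = 1`. -/
lemma deviation_bounds_le_threshold {K N : ℕ} {ε δ ρ : ℝ} {T : ℕ} (hε : 0 < ε)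
    (hρ1 : ρ ≤ 1) (he : 0 ≤ confTerm N δ T) :
    2 * √(2 * K * ρ * confTerm N δ T / ε) + (K / ε + 1) * confTerm N δ T
      + (2 * √(ρ * confTerm N δ T) + 2 * confTerm N δ T) ≤ threshold K N ε δ T := by
  unfold threshold
  set e := confTerm N δ T
  have h1 : √(2 * K * ρ * e / ε) ≤ √(2 * K / ε) * √e := by
    rw [← Real.sqrt_mul (by positivity)]
    refine Real.sqrt_le_sqrt ?_
    calc 2 * K * ρ * e / ε = ρ * (2 * K / ε * e) := by ring
      _ ≤ 1 * (2 * K / ε * e) := mul_le_mul_of_nonneg_right hρ1 (by positivity)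
      _ = _ := one_mul _
  have h2 : √(ρ * e) ≤ √e := Real.sqrt_le_sqrt (mul_le_of_le_one_left he hρ1)
  linarith

namespace Interaction

section Pathwise

variable {X Ω : Type*} {K : ℕ} {I : Interaction X Ω K} {ω : Ω}

lemma trueEmp_le_biasedEmp (hl : ∀ t b, I.loss t ω b ∈ Set.Icc (0 : ℝ) 1) (T : ℕ)
    (π : X → Fin K) : I.trueEmp T ω π ≤ I.biasedEmp T ω π := by
  unfold trueEmp biasedEmp empLoss
  gcongr with t _
  exact loss_le_biasedLoss (hl t) _

lemma biasedEmp_eq_trueEmp {T : ℕ} {π : X → Fin K}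
    (hex : ∀ t < T, π (I.x t ω) ∈ I.explored t ω) : I.biasedEmp T ω π = I.trueEmp T ω π := by
  unfold trueEmp biasedEmp empLoss
  congr 1
  refine Finset.sum_congr rfl fun t ht => ?_
  simp only [biasedLoss, if_pos (hex t (Finset.mem_range.mp ht))]

/-- The regret of round `t`. -/
noncomputable def roundRegret (I : Interaction X Ω K) (πstar : X → Fin K) (t : ℕ) (ω : Ω) : ℝ :=
  I.loss t ω (I.act t ω) - I.loss t ω (πstar (I.x t ω))

lemma regret_eq_sum (I : Interaction X Ω K) (πstar : X → Fin K) (T : ℕ) (ω : Ω) :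
    I.regret πstar T ω = ∑ t ∈ Finset.range T, I.roundRegret πstar t ω := by
  simp only [regret, roundRegret, Finset.sum_sub_distrib]

/-- The mass off the greedy action is at most ε, and losses lie in `[0, 1]`. -/
lemma sum_prob_mul_loss_le {I : Interaction X Ω K} {ε : ℝ} {t : ℕ} {ω : Ω} (hε : 0 < ε)
    (hε1 : ε ≤ 1) (hg : I.greedy t ω (I.x t ω) ∈ I.explored t ω)
    (hl : ∀ b, I.loss t ω b ∈ Set.Icc (0 : ℝ) 1) :
    ∑ b, I.prob ε t ω b * I.loss t ω b ≤ I.loss t ω (I.greedy t ω (I.x t ω)) + ε := by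
  set g := I.greedy t ω (I.x t ω) with hgdef
  have h1 : ∑ b, I.prob ε t ω b * I.loss t ω b
      ≤ ∑ b, (I.prob ε t ω b * I.loss t ω g
        + (I.prob ε t ω b - if b = g then I.prob ε t ω b else 0)) := by
    refine Finset.sum_le_sum fun b _ => ?_
    have hp := prob_nonneg (I := I) (t := t) (ω := ω) hε hε1 b
    split_ifs with hb
    · rw [hb]; linarith
    · nlinarith [(hl b).2, (hl g).1]
  rw [Finset.sum_add_distrib, ← Finset.sum_mul, Finset.sum_sub_distrib, sum_prob hg] at h1
  simp only [Finset.sum_ite_eq', Finset.mem_univ, if_true, one_mul] at h1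
  have h2 : 1 - ε ≤ I.prob ε t ω g := one_sub_le_playProb_self hε.le
  linarith

end Pathwise

variable {X Ω : Type*} {K : ℕ} [MeasurableSpace X] [mΩ : MeasurableSpace Ω]

namespace IsRun

variable {I : Interaction X Ω K} {ℱ : Filtration ℕ mΩ} {μ : Measure Ω}
  {D : Measure (X × (Fin K → ℝ))} [IsProbabilityMeasure D] {P : Finset (X → Fin K)} {ε δ : ℝ}
  {πstar : X → Fin K} {ω : Ω}

/-- Past exploration of `πstar` makes its biased average exact, while that of the greedy policy is
at least its true average. With both deviation bounds, the true gap is at most the estimated gap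
plus the threshold. The first claim then uses that the true gap is nonnegative, the second that the
estimated gap is nonpositive. -/
lemma star_le_and_gap_le (h : I.IsRun ℱ μ D P ε δ) (hδ : 0 < δ) (hδ1 : δ < 1) (hε : 0 < ε)
    (hstar : πstar ∈ P) (hmin : ∀ π ∈ P, expLoss D πstar ≤ expLoss D π)
    (hl : ∀ t b, I.loss t ω b ∈ Set.Icc (0 : ℝ) 1) (hω : ω ∈ I.deviationEvent D P πstar ε δ)
    {t : ℕ} (ht : 1 ≤ t) (hex : ∀ s < t, πstar (I.x s ω) ∈ I.explored s ω) :
    I.ipsEmp ε t ω πstar - I.ipsEmp ε t ω (I.greedy t ω) ≤ threshold K P.card ε δ t ∧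
      expLoss D (I.greedy t ω) - expLoss D πstar ≤ threshold K P.card ε δ t := by
  have hg := h.greedy_mem t ω
  obtain ⟨h1, h2⟩ := hω _ hg t ht
  have h3 := deviation_bounds_le_threshold (K := K) (ρ := disagreement D (I.greedy t ω) πstar) hε
    measureReal_le_one
    (confTerm_nonneg (Finset.card_pos.mpr ⟨_, hstar⟩) hδ hδ1 t)
  have h4 := trueEmp_le_biasedEmp hl t (I.greedy t ω)
  have h5 := biasedEmp_eq_trueEmp hex
  have h6 := hmin _ hg
  have h7 := h.greedy_min t ω _ hstar
  rw [abs_le] at h1 h2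
  constructor <;> linarith [h1.1, h1.2, h2.1, h2.2]

/-- On the deviation event the optimal policy is never eliminated. -/
lemma star_mem_explored (h : I.IsRun ℱ μ D P ε δ) (hδ : 0 < δ) (hδ1 : δ < 1) (hε : 0 < ε)
    (hstar : πstar ∈ P) (hmin : ∀ π ∈ P, expLoss D πstar ≤ expLoss D π)
    (hl : ∀ t b, I.loss t ω b ∈ Set.Icc (0 : ℝ) 1) (hω : ω ∈ I.deviationEvent D P πstar ε δ)
    (t : ℕ) : πstar (I.x t ω) ∈ I.explored t ω := by
  induction t using Nat.strong_induction_on with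
  | _ t ih =>
    rcases Nat.eq_zero_or_pos t with rfl | ht
    · simp [h.explored_zero]
    · rw [h.mem_explored t ht]
      exact ⟨_, hstar, rfl, (h.star_le_and_gap_le hδ hδ1 hε hstar hmin hl hω ht ih).1⟩

/-- On the deviation event the greedy policy is nearly optimal. -/
lemma gap_le_threshold (h : I.IsRun ℱ μ D P ε δ) (hδ : 0 < δ) (hδ1 : δ < 1) (hε : 0 < ε)
    (hstar : πstar ∈ P) (hmin : ∀ π ∈ P, expLoss D πstar ≤ expLoss D π)
    (hl : ∀ t b, I.loss t ω b ∈ Set.Icc (0 : ℝ) 1) (hω : ω ∈ I.deviationEvent D P πstar ε δ)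
    {t : ℕ} (ht : 1 ≤ t) :
    expLoss D (I.greedy t ω) - expLoss D πstar ≤ threshold K P.card ε δ t :=
  (h.star_le_and_gap_le hδ hδ1 hε hstar hmin hl hω ht
    fun s _ => h.star_mem_explored hδ hδ1 hε hstar hmin hl hω s).2

end IsRun

/-! ### Regret of one round -/

namespace IsRun

variable {I : Interaction X Ω K} {ℱ : Filtration ℕ mΩ} {μ : Measure Ω}
  {D : Measure (X × (Fin K → ℝ))} {P : Finset (X → Fin K)} {ε δ : ℝ} {πstar : X → Fin K}

lemma measurable_roundRegret (h : I.IsRun ℱ μ D P ε δ) (hstar : Measurable πstar) (t : ℕ) :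
    Measurable[ℱ (t + 1)] (I.roundRegret πstar t) :=
  (measurable_eval_fin (F := fun c ω => I.loss t ω c)
    (fun c => (measurable_loss_preAct I ℱ t c).mono (h.preAct_le_succ t) le_rfl)
    (h.measurable_act t)).sub
    ((measurable_loss_policy I ℱ t hstar).mono (h.preAct_le_succ t) le_rfl)

lemma ae_abs_roundRegret_le (h : I.IsRun ℱ μ D P ε δ)
    (hD : ∀ᵐ z ∂D, ∀ b, z.2 b ∈ Set.Icc (0 : ℝ) 1) (t : ℕ) :
    ∀ᵐ ω ∂μ, |I.roundRegret πstar t ω| ≤ 1 := by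
  filter_upwards [h.ae_loss_mem_Icc hD] with ω hl
  have h1 := hl t (I.act t ω)
  have h2 := hl t (πstar (I.x t ω))
  unfold roundRegret
  rw [abs_le]
  constructor <;> linarith [h1.1, h1.2, h2.1, h2.2]

lemma ae_abs_regret_le (h : I.IsRun ℱ μ D P ε δ)
    (hD : ∀ᵐ z ∂D, ∀ b, z.2 b ∈ Set.Icc (0 : ℝ) 1) (T : ℕ) :
    ∀ᵐ ω ∂μ, |I.regret πstar T ω| ≤ T := by
  simp only [regret_eq_sum]
  simpa using ae_abs_sum_range_le (h.ae_abs_roundRegret_le (πstar := πstar) hD) T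

lemma measurable_regret (h : I.IsRun ℱ μ D P ε δ) (hstar : Measurable πstar) (T : ℕ) :
    Measurable (I.regret πstar T) := by
  have := (measurable_sum_range (h.measurable_roundRegret hstar) T).mono (ℱ.le _) le_rfl
  exact (funext fun ω => regret_eq_sum I πstar T ω) ▸ this

lemma ae_abs_condExp_roundRegret_le (h : I.IsRun ℱ μ D P ε δ)
    (hD : ∀ᵐ z ∂D, ∀ b, z.2 b ∈ Set.Icc (0 : ℝ) 1) (t : ℕ) :
    ∀ᵐ ω ∂μ, |(μ[I.roundRegret πstar t | ℱ t]) ω| ≤ 1 :=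
  ae_bdd_abs_condExp_of_ae_bdd_abs (h.ae_abs_roundRegret_le hD t)

variable [IsProbabilityMeasure μ]

lemma integrable_roundRegret (h : I.IsRun ℱ μ D P ε δ)
    (hD : ∀ᵐ z ∂D, ∀ b, z.2 b ∈ Set.Icc (0 : ℝ) 1) (hstar : Measurable πstar) (t : ℕ) :
    Integrable (I.roundRegret πstar t) μ :=
  integrable_of_ae_abs_le ((h.measurable_roundRegret hstar t).mono (ℱ.le _) le_rfl)
    (h.ae_abs_roundRegret_le hD t)

/-- The conditional mean of the loss difference between the greedy policy and `πstar`. -/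
lemma condExp_greedy_loss [IsProbabilityMeasure D] (h : I.IsRun ℱ μ D P ε δ)
    (hP : ∀ π ∈ P, Measurable π)
    (hD : ∀ᵐ z ∂D, ∀ b, z.2 b ∈ Set.Icc (0 : ℝ) 1) (hstar : Measurable πstar) (t : ℕ) :
    μ[fun ω => I.loss t ω (I.greedy t ω (I.x t ω)) - I.loss t ω (πstar (I.x t ω)) | ℱ t]
      =ᵐ[μ] fun ω => expLoss D (I.greedy t ω) - expLoss D πstar := by
  classical
  set H : (X → Fin K) → Ω → ℝ := fun π ω => I.loss t ω (π (I.x t ω)) - I.loss t ω (πstar (I.x t ω))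
    with hH
  -- The indicators of the possible greedy policies are known from the past and can be pulled out,
  -- leaving for each fixed policy a mean over fresh data.
  set J : (X → Fin K) → Ω → ℝ := fun π => {ω | I.greedy t ω = π}.indicator fun _ => 1 with hJ
  have hpick : ∀ (F : (X → Fin K) → Ω → ℝ) (ω : Ω),
      ∑ π ∈ P, J π ω * F π ω = F (I.greedy t ω) ω := by
    intro F ω
    rw [Finset.sum_eq_single_of_mem _ (h.greedy_mem t ω)]
    · simp [hJ]
    · intro π _ hne
      simp [hJ, hne.symm]
  have hHm : ∀ π ∈ P, Measurable (H π) := fun π hπ =>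
    ((measurable_loss_policy I ℱ t (hP π hπ)).sub (measurable_loss_policy I ℱ t hstar)).mono
      (h.preAct_le t) le_rfl
  have hHb : ∀ π, ∀ᵐ ω ∂μ, |H π ω| ≤ 1 := by
    intro π
    filter_upwards [h.ae_loss_mem_Icc hD] with ω hl
    have h1 := hl t (π (I.x t ω))
    have h2 := hl t (πstar (I.x t ω))
    simp only [hH]
    rw [abs_le]
    constructor <;> linarith [h1.1, h1.2, h2.1, h2.2]
  have hJm : ∀ π ∈ P, Measurable[ℱ t] (J π) := fun π hπ =>
    measurable_const.indicator (h.measurable_greedy t π hπ)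
  have hJb : ∀ π ω, |J π ω| ≤ 1 := by
    intro π ω
    simp only [hJ, Set.indicator_apply]
    split_ifs <;> simp
  have hint : ∀ π ∈ P, Integrable (J π * H π) μ := by
    intro π hπ
    refine integrable_of_ae_abs_le (R := 1)
      (((hJm π hπ).mono (ℱ.le t) le_rfl).mul (hHm π hπ)) ?_
    filter_upwards [hHb π] with ω hω
    rw [Pi.mul_apply, abs_mul]
    exact mul_le_one₀ (hJb π ω) (abs_nonneg _) hω
  have hsum : (fun ω => I.loss t ω (I.greedy t ω (I.x t ω)) - I.loss t ω (πstar (I.x t ω)))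
      = ∑ π ∈ P, J π * H π := by
    ext ω
    rw [Finset.sum_apply]
    exact (hpick H ω).symm
  have hmean : ∀ π ∈ P, μ[H π | ℱ t] =ᵐ[μ] fun _ => expLoss D π - expLoss D πstar := by
    intro π hπ
    refine (h.condExp_data t (f := fun z => z.2 (π z.1) - z.2 (πstar z.1))
      ((measurable_policy_loss (hP π hπ)).sub (measurable_policy_loss hstar))).trans
      (.of_forall fun ω => ?_)
    exact integral_sub (integrable_policy_loss hD (hP π hπ)) (integrable_policy_loss hD hstar)
  have hpull : ∀ π ∈ P, μ[J π * H π | ℱ t] =ᵐ[μ] J π * μ[H π | ℱ t] := fun π hπ =>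
    condExp_mul_of_stronglyMeasurable_left (hJm π hπ).stronglyMeasurable (hint π hπ)
      (integrable_of_ae_abs_le (hHm π hπ) (hHb π))
  rw [hsum]
  have hmean' := (ae_ball_iff P.countable_toSet).mpr hmean
  have hpull' := (ae_ball_iff P.countable_toSet).mpr hpull
  filter_upwards [condExp_finsetSum hint (ℱ t), hmean', hpull'] with ω h1 h2 h3
  rw [h1, Finset.sum_apply, ← hpick (fun π _ => expLoss D π - expLoss D πstar) ω]
  refine Finset.sum_congr rfl fun π hπ => ?_
  rw [h3 π hπ, Pi.mul_apply, h2 π hπ]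

lemma condExp_roundRegret_le [IsProbabilityMeasure D] (h : I.IsRun ℱ μ D P ε δ)
    (hP : ∀ π ∈ P, Measurable π)
    (hD : ∀ᵐ z ∂D, ∀ b, z.2 b ∈ Set.Icc (0 : ℝ) 1) (hδ : 0 < δ) (hδ1 : δ < 1)
    (hε : 0 < ε) (hε1 : ε ≤ 1) (hstar : Measurable πstar) (t : ℕ) :
    μ[I.roundRegret πstar t | ℱ t]
      ≤ᵐ[μ] fun ω => expLoss D (I.greedy t ω) - expLoss D πstar + ε := by
  set G : Ω → ℝ := fun ω => I.loss t ω (I.greedy t ω (I.x t ω)) - I.loss t ω (πstar (I.x t ω))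
    with hG
  have hGm : Measurable G :=
    ((measurable_eval_fin (F := fun c ω => I.loss t ω c) (measurable_loss_preAct I ℱ t)
      (h.measurable_greedyAction hP t)).sub (measurable_loss_policy I ℱ t hstar)).mono
      (h.preAct_le t) le_rfl
  have hGi : Integrable G μ := by
    refine integrable_of_ae_abs_le (R := 1) hGm ?_
    filter_upwards [h.ae_loss_mem_Icc hD] with ω hl
    have h1 := hl t (I.greedy t ω (I.x t ω))
    have h2 := hl t (πstar (I.x t ω))
    simp only [hG]
    rw [abs_le]
    constructor <;> linarith [h1.1, h1.2, h2.1, h2.2]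
  have hact := h.condExp_act (t := t) (C := 1)
    (F := fun a ω => I.loss t ω a - I.loss t ω (πstar (I.x t ω)))
    (fun a => (measurable_loss_preAct I ℱ t a).sub (measurable_loss_policy I ℱ t hstar)) (by
      filter_upwards [h.ae_loss_mem_Icc hD] with ω hl a
      have h1 := hl t a
      have h2 := hl t (πstar (I.x t ω))
      rw [abs_le]
      constructor <;> linarith [h1.1, h1.2, h2.1, h2.2])
  have h1 : μ[I.roundRegret πstar t | I.preAct ℱ t] ≤ᵐ[μ] G + fun _ => ε := by
    filter_upwards [hact, h.ae_loss_mem_Icc hD] with ω h2 hl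
    have h3 : (μ[I.roundRegret πstar t | I.preAct ℱ t]) ω = _ := h2
    have hg := h.greedy_mem_explored hδ hδ1 hε t ω
    rw [h3, Pi.add_apply]
    simp only [mul_sub, Finset.sum_sub_distrib, ← Finset.sum_mul, sum_prob hg, one_mul, hG]
    linarith [sum_prob_mul_loss_le hε hε1 hg (hl t)]
  have h2 := condExp_mono (m := ℱ t) integrable_condExp (hGi.add (integrable_const ε)) h1
  filter_upwards [h2, h.condExp_greedy_loss hP hD hstar t,
    condExp_add hGi (integrable_const ε) (ℱ t), condExp_condExp_of_le (μ := μ)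
    (f := I.roundRegret πstar t) (le_preAct I ℱ t) (h.preAct_le t)] with ω h3 h4 h5 h6
  rw [h6, h5, Pi.add_apply, condExp_const (ℱ.le t), h4] at h3
  exact h3

end IsRun

end Interaction

/-! ### Numerical bounds -/

lemma sum_inv_sqrt_le (T : ℕ) : ∑ t ∈ Finset.range T, 1 / √((t : ℝ) + 1) ≤ 2 * √T := by
  induction T with
  | zero => simp
  | succ T ih =>
    rw [Finset.sum_range_succ]
    have h0 : 0 < √((T : ℝ) + 1) := Real.sqrt_pos.mpr (by positivity)
    have h1 : √((T : ℝ) + 1) ^ 2 = T + 1 := Real.sq_sqrt (by positivity)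
    have h2 : √(T : ℝ) ^ 2 = T := Real.sq_sqrt (by positivity)
    have h3 : 1 / √((T : ℝ) + 1) ≤ 2 * √((T : ℝ) + 1) - 2 * √T := by
      rw [div_le_iff₀ h0]
      nlinarith [sq_nonneg (√((T : ℝ) + 1) - √T)]
    push_cast
    linarith

lemma log_pos_of_le {N T : ℕ} {δ : ℝ} (hN : 1 ≤ N) (hT : 1 ≤ T) (hδ : 0 < δ) (hδ1 : δ < 1) :
    0 < Real.log (T * N / δ) := by
  have hN1 : (1 : ℝ) ≤ N := by exact_mod_cast hN
  have hT1 : (1 : ℝ) ≤ T := by exact_mod_cast hT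
  refine Real.log_pos ?_
  rw [lt_div_iff₀ hδ]
  nlinarith

/-- With two policies the logarithm is at least `log 2`. With one policy, `T = 1` and δ near 1, it
is close to 0, so the case `N = 1` needs a separate argument. -/
lemma half_le_log {N T : ℕ} {δ : ℝ} (hN : 2 ≤ N) (hT : 1 ≤ T) (hδ : 0 < δ) (hδ1 : δ < 1) :
    1 / 2 ≤ Real.log (T * N / δ) := by
  have hN1 : (2 : ℝ) ≤ N := by exact_mod_cast hN
  have hT1 : (1 : ℝ) ≤ T := by exact_mod_cast hT
  have h1 : Real.log 2 ≤ Real.log (T * N / δ) := by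
    refine Real.log_le_log two_pos ?_
    rw [le_div_iff₀ hδ]
    nlinarith
  linarith [Real.log_two_gt_d9]

/-- One factor 2 comes from `2N(t² + t) / δ ≤ (TN / δ)²`, where `2 ≤ N` absorbs the 2 and `t < T`
gives `t² + t ≤ T²`; the other from `t + 1 ≤ 2t`. -/
lemma confTerm_le {N t T : ℕ} {δ : ℝ} (hN : 2 ≤ N) (ht : 1 ≤ t) (htT : t < T) (hδ : 0 < δ)
    (hδ1 : δ < 1) : confTerm N δ t ≤ 4 * (Real.log (T * N / δ) / (t + 1)) := by
  have hN2 : (2 : ℝ) ≤ N := by exact_mod_cast hN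
  have ht1 : (1 : ℝ) ≤ t := by exact_mod_cast ht
  have htT1 : (t : ℝ) + 1 ≤ T := by exact_mod_cast htT
  have hlog0 := log_pos_of_le (by omega : 1 ≤ N) (by omega : 1 ≤ T) hδ hδ1
  have hlog : Real.log (2 * N / (δ / ((t : ℝ) ^ 2 + t))) ≤ 2 * Real.log (T * N / δ) := by
    have h2 : 2 * Real.log (T * N / δ) = Real.log ((T * N / δ) ^ 2) := by
      rw [Real.log_pow]; norm_num
    rw [h2]
    refine Real.log_le_log (by positivity) ?_
    rw [div_div_eq_mul_div, div_pow, div_le_div_iff₀ hδ (by positivity)]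
    have h3 : (t : ℝ) ^ 2 + t ≤ T ^ 2 := by nlinarith
    have h4 : 2 * N * ((t : ℝ) ^ 2 + t) ≤ (T * N) ^ 2 := by
      calc 2 * N * ((t : ℝ) ^ 2 + t) ≤ (N : ℝ) * N * T ^ 2 := by gcongr
        _ = ((T : ℝ) * N) ^ 2 := by ring
    have h5 : δ ^ 2 ≤ δ := by nlinarith
    calc 2 * N * ((t : ℝ) ^ 2 + t) * δ ^ 2 ≤ (T * N) ^ 2 * δ ^ 2 := by gcongr
      _ ≤ (T * N) ^ 2 * δ := by gcongr
  unfold confTerm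
  calc _ ≤ 2 * Real.log (T * N / δ) / t := by gcongr
    _ ≤ _ := by
      rw [← mul_div_assoc, div_le_div_iff₀ (by positivity) (by positivity)]
      nlinarith

/-- Capping at 1 removes the linear term of the threshold: with `w = (K / ε) y`, either `w > 1` and
the cap suffices, or `w ≤ √w`. In the latter case the constant is `2 * (3 + 2) + 16 = 26`. -/
lemma min_one_threshold_le {K N t T : ℕ} {ε δ : ℝ} (hK : 1 ≤ K) (hN : 2 ≤ N) (ht : 1 ≤ t)
    (htT : t < T) (hε : 0 < ε) (hε1 : ε ≤ 1) (hδ : 0 < δ) (hδ1 : δ < 1) :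
    min 1 (threshold K N ε δ t) ≤ 26 * √(K / ε * (Real.log (T * N / δ) / (t + 1))) := by
  have hc := confTerm_le hN ht htT hδ hδ1
  have he := confTerm_nonneg (by omega : 1 ≤ N) hδ hδ1 t
  have hκ : 1 ≤ (K : ℝ) / ε := by
    have : (1 : ℝ) ≤ K := by exact_mod_cast hK
    rw [le_div_iff₀ hε]; linarith
  have hlog0 := log_pos_of_le (by omega : 1 ≤ N) (by omega : 1 ≤ T) hδ hδ1
  set y := Real.log (T * N / δ) / ((t : ℝ) + 1) with hy
  have hy0 : 0 ≤ y := by positivity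
  set w := K / ε * y with hw
  have hw0 : 0 ≤ w := by positivity
  have hyw : y ≤ w := le_mul_of_one_le_left hy0 hκ
  set q := √w with hq
  have hq0 : 0 ≤ q := Real.sqrt_nonneg _
  have hq2 : q ^ 2 = w := Real.sq_sqrt hw0
  rcases le_or_gt w 1 with hw1 | hw1
  swap
  · have : 1 ≤ q := Real.one_le_sqrt.mpr hw1.le
    exact (min_le_left _ _).trans (by linarith)
  refine (min_le_right _ _).trans ?_
  unfold threshold
  set e := confTerm N δ t
  have h1 : √(2 * K / ε) * √e ≤ 3 * q := by
    rw [← Real.sqrt_mul (by positivity)]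
    refine Real.sqrt_le_iff.mpr ⟨by positivity, ?_⟩
    calc 2 * K / ε * e ≤ 2 * K / ε * (4 * y) := by gcongr
      _ = 8 * w := by rw [hw]; ring
      _ ≤ (3 * q) ^ 2 := by rw [mul_pow, hq2]; linarith
  have h2 : √e ≤ 2 * q := by
    refine Real.sqrt_le_iff.mpr ⟨by positivity, ?_⟩
    rw [mul_pow, hq2]; linarith
  have h3 : (K / ε + 3) * e ≤ 16 * w := by
    calc (K / ε + 3) * e ≤ (4 * (K / ε)) * (4 * y) := by gcongr; linarith
      _ = 16 * w := by rw [hw]; ring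
  have h4 : w ≤ q := by
    have : q ≤ 1 := Real.sqrt_le_one.mpr hw1
    nlinarith
  linarith

/-- Absorbs lower-order terms into the rate: the martingale noise with `S = T`, and the cost of the
first round with `S = 1`. -/
lemma sqrt_le_two_mul_sqrt {K N T : ℕ} {ε δ : ℝ} (hK : 1 ≤ K) (hN : 2 ≤ N) (hT : 1 ≤ T)
    (hε : 0 < ε) (hε1 : ε ≤ 1) (hδ : 0 < δ) (hδ1 : δ < 1) (S : ℕ) :
    √S ≤ 2 * √(K * S * Real.log (T * N / δ) / ε) := by
  have hκ : 1 ≤ (K : ℝ) / ε := by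
    have : (1 : ℝ) ≤ K := by exact_mod_cast hK
    rw [le_div_iff₀ hε]; linarith
  have hlog := half_le_log hN hT hδ hδ1
  refine Real.sqrt_le_iff.mpr ⟨by positivity, ?_⟩
  rw [mul_pow, Real.sq_sqrt (by positivity)]
  have h1 : 1 / 2 ≤ K / ε * Real.log (T * N / δ) := by nlinarith
  calc (S : ℝ) ≤ 4 * (S * (1 / 2)) := by linarith [Nat.cast_nonneg (α := ℝ) S]
    _ ≤ 4 * (S * (K / ε * Real.log (T * N / δ))) := by gcongr
    _ = _ := by ring

namespace Interaction.IsRun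

/-! ### Regret on the deviation event -/

variable {X Ω : Type*} {K : ℕ} [MeasurableSpace X] {D : Measure (X × (Fin K → ℝ))}
  {P : Finset (X → Fin K)} {ε δ : ℝ} {πstar : X → Fin K}

/-- For a single policy all loss differences vanish, so conditioning has no effect. -/
lemma deviationEvent_eq_univ (I : Interaction X Ω K) (hδ : 0 < δ) (hδ1 : δ < 1)
    (hε : 0 < ε) (hstar : πstar ∈ P) (hcard : P.card = 1) :
    I.deviationEvent D P πstar ε δ = Set.univ := by
  refine Set.eq_univ_of_forall fun ω π hπ T _ => ?_
  obtain rfl : π = πstar := Finset.card_le_one.mp hcard.le π hπ πstar hstar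
  have := confTerm_nonneg hcard.ge hδ hδ1 T
  simp only [sub_self, abs_zero]
  constructor <;> positivity

lemma one_le_numActions [IsProbabilityMeasure D] (π : X → Fin K) : 1 ≤ K := by
  obtain ⟨z⟩ := nonempty_of_isProbabilityMeasure D
  exact Fin.pos (π z.1)

variable [mΩ : MeasurableSpace Ω] {I : Interaction X Ω K} {ℱ : Filtration ℕ mΩ} {μ : Measure Ω}

lemma integral_cond_le {E : Set Ω} (hE : 1 / 2 ≤ μ.real E) {f : Ω → ℝ} {B : ℝ} (hB : 0 ≤ B)
    (hf : ∫ ω in E, f ω ∂μ ≤ B) : ∫ ω, f ω ∂μ[|E] ≤ 2 * B := by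
  rw [ProbabilityTheory.cond, integral_smul_measure, ENNReal.toReal_inv, smul_eq_mul]
  change (μ.real E)⁻¹ * _ ≤ _
  have h1 : (μ.real E)⁻¹ ≤ 2 := by
    rw [inv_le_comm₀ (by linarith) two_pos]; linarith
  have h0 : 0 ≤ (μ.real E)⁻¹ := inv_nonneg.mpr measureReal_nonneg
  calc _ ≤ (μ.real E)⁻¹ * B := mul_le_mul_of_nonneg_left hf h0
    _ ≤ 2 * B := mul_le_mul_of_nonneg_right h1 hB

lemma integrable_regret_cond (h : I.IsRun ℱ μ D P ε δ)
    (hD : ∀ᵐ z ∂D, ∀ b, z.2 b ∈ Set.Icc (0 : ℝ) 1) (hstar : Measurable πstar) (T : ℕ)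
    (E : Set Ω) : Integrable (I.regret πstar T) μ[|E] := by
  have hac : μ[|E] ≪ μ := cond_absolutelyContinuous
  exact integrable_of_ae_abs_le (h.measurable_regret hstar T) (hac.ae_le (h.ae_abs_regret_le hD T))

/-- The martingale part of the regret of round `t`. -/
noncomputable def regretNoise (I : Interaction X Ω K) (ℱ : Filtration ℕ mΩ) (μ : Measure Ω)
    (πstar : X → Fin K) (t : ℕ) (ω : Ω) : ℝ :=
  I.roundRegret πstar t ω - (μ[I.roundRegret πstar t | ℱ t]) ω

lemma measurable_regretNoise (h : I.IsRun ℱ μ D P ε δ) (hstar : Measurable πstar) (t : ℕ) :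
    Measurable[ℱ (t + 1)] (regretNoise I ℱ μ πstar t) :=
  (h.measurable_roundRegret hstar t).sub
    (stronglyMeasurable_condExp.measurable.mono (ℱ.mono (Nat.le_succ t)) le_rfl)

lemma ae_abs_regretNoise_le (h : I.IsRun ℱ μ D P ε δ)
    (hD : ∀ᵐ z ∂D, ∀ b, z.2 b ∈ Set.Icc (0 : ℝ) 1) (t : ℕ) :
    ∀ᵐ ω ∂μ, |regretNoise I ℱ μ πstar t ω| ≤ 2 := by
  filter_upwards [h.ae_abs_roundRegret_le (πstar := πstar) hD t,
    h.ae_abs_condExp_roundRegret_le (πstar := πstar) hD t] with ω h1 h2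
  exact (abs_sub _ _).trans (by linarith)

lemma integral_regret_cond_le_horizon (h : I.IsRun ℱ μ D P ε δ)
    (hD : ∀ᵐ z ∂D, ∀ b, z.2 b ∈ Set.Icc (0 : ℝ) 1) (hstar : Measurable πstar) (T : ℕ)
    (E : Set Ω) : ∫ ω, I.regret πstar T ω ∂μ[|E] ≤ T := by
  have hac : μ[|E] ≪ μ := cond_absolutelyContinuous
  have hle : ∀ᵐ ω ∂μ, I.regret πstar T ω ≤ T :=
    (h.ae_abs_regret_le hD T).mono fun ω hω => (le_abs_self _).trans hω
  have h1 := integral_mono_ae (h.integrable_regret_cond hD hstar T E) (integrable_const (T : ℝ))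
    (hac.ae_le hle)
  refine h1.trans ?_
  rw [integral_const, smul_eq_mul]
  exact mul_le_of_le_one_left (Nat.cast_nonneg _) measureReal_le_one

variable [IsProbabilityMeasure μ]

lemma condExp_regretNoise (h : I.IsRun ℱ μ D P ε δ)
    (hD : ∀ᵐ z ∂D, ∀ b, z.2 b ∈ Set.Icc (0 : ℝ) 1) (hstar : Measurable πstar) (t : ℕ) :
    μ[regretNoise I ℱ μ πstar t | ℱ t] =ᵐ[μ] 0 := by
  have hi := h.integrable_roundRegret hD hstar t
  refine (condExp_sub hi integrable_condExp (ℱ t)).trans ?_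
  rw [condExp_of_stronglyMeasurable (ℱ.le t) stronglyMeasurable_condExp integrable_condExp,
    sub_self]

/-- Since `E` is not tied to the filtration, the noise is not centered on it. It is bounded instead
through its absolute mean over the whole space, using orthogonality of the increments. -/
lemma setIntegral_sum_regretNoise_le (h : I.IsRun ℱ μ D P ε δ)
    (hD : ∀ᵐ z ∂D, ∀ b, z.2 b ∈ Set.Icc (0 : ℝ) 1) (hstar : Measurable πstar) {T : ℕ}
    (hT : 1 ≤ T) (E : Set Ω) :
    ∫ ω in E, ∑ t ∈ Finset.range T, regretNoise I ℱ μ πstar t ω ∂μ ≤ 5 / 2 * √T := by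
  set M : Ω → ℝ := fun ω => ∑ t ∈ Finset.range T, regretNoise I ℱ μ πstar t ω with hM
  have hMm : Measurable M :=
    (measurable_sum_range (h.measurable_regretNoise hstar) T).mono (ℱ.le _) le_rfl
  have hMb : ∀ᵐ ω ∂μ, |M ω| ≤ T * 2 := ae_abs_sum_range_le (h.ae_abs_regretNoise_le hD) T
  have hM2 : Integrable (fun ω => M ω ^ 2) μ := by
    refine integrable_of_ae_abs_le (R := (T * 2) ^ 2) (hMm.pow_const 2) ?_
    filter_upwards [hMb] with ω hω
    rw [abs_pow]; exact pow_le_pow_left₀ (abs_nonneg _) hω 2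
  have hsq : ∫ ω, M ω ^ 2 ∂μ ≤ T * 2 ^ 2 := integral_sum_range_sq_le
    (h.measurable_regretNoise hstar) (h.ae_abs_regretNoise_le hD)
    (h.condExp_regretNoise hD hstar) T
  have hs : 0 < √(T : ℝ) := Real.sqrt_pos.mpr (by exact_mod_cast hT)
  have hs2 : √(T : ℝ) ^ 2 = T := Real.sq_sqrt (by positivity)
  have hMi : Integrable M μ := integrable_of_ae_abs_le hMm hMb
  have hdom : Integrable (fun ω => (2 * √(T : ℝ))⁻¹ * M ω ^ 2 + √(T : ℝ) / 2) μ :=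
    (hM2.const_mul _).add (integrable_const _)
  calc ∫ ω in E, M ω ∂μ ≤ ∫ ω in E, |M ω| ∂μ :=
        integral_mono hMi.integrableOn hMi.abs.integrableOn fun ω => le_abs_self _
    _ ≤ ∫ ω, |M ω| ∂μ := setIntegral_le_integral hMi.abs (.of_forall fun ω => abs_nonneg _)
    -- Arithmetic-geometric mean inequality; with second moment at most `4T` it yields `2√T + √T /
    -- 2`.
    _ ≤ ∫ ω, ((2 * √(T : ℝ))⁻¹ * M ω ^ 2 + √(T : ℝ) / 2) ∂μ := by
        refine integral_mono hMi.abs hdom fun ω => ?_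
        have h1 : (2 * √(T : ℝ))⁻¹ * M ω ^ 2 + √(T : ℝ) / 2 - |M ω|
            = (2 * √(T : ℝ))⁻¹ * (|M ω| - √T) ^ 2 := by
          rw [← sq_abs (M ω)]; field_simp; ring
        have h2 : 0 ≤ (2 * √(T : ℝ))⁻¹ * (|M ω| - √T) ^ 2 := by positivity
        linarith
    _ = (2 * √(T : ℝ))⁻¹ * ∫ ω, M ω ^ 2 ∂μ + √(T : ℝ) / 2 := by
        rw [integral_add (hM2.const_mul _) (integrable_const _), integral_const_mul]
        simp
    _ ≤ (2 * √(T : ℝ))⁻¹ * (T * 2 ^ 2) + √(T : ℝ) / 2 := by gcongr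
    _ = 5 / 2 * √T := by
        have : (T : ℝ) * 2 ^ 2 = 4 * (√T * √T) := by rw [← sq, hs2]; ring
        rw [this]; field_simp; ring

variable [IsProbabilityMeasure D]

/-- The greedy policy is the optimal one, so only exploration costs. Without conditioning the noise
has mean zero and no `√T` term has to be absorbed. -/
lemma integral_regret_le_of_card_eq_one (h : I.IsRun ℱ μ D P ε δ) (hP : ∀ π ∈ P, Measurable π)
    (hD : ∀ᵐ z ∂D, ∀ b, z.2 b ∈ Set.Icc (0 : ℝ) 1) (hδ : 0 < δ) (hδ1 : δ < 1)
    (hε : 0 < ε) (hε1 : ε ≤ 1) (hstar : πstar ∈ P) (hcard : P.card = 1) (T : ℕ) :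
    ∫ ω, I.regret πstar T ω ∂μ ≤ T * ε := by
  have hi := h.integrable_roundRegret hD (hP _ hstar)
  simp only [regret_eq_sum]
  rw [integral_finsetSum _ fun t _ => hi t]
  have hround : ∀ t, ∫ ω, I.roundRegret πstar t ω ∂μ ≤ ε := by
    intro t
    rw [← integral_condExp (ℱ.le t)]
    calc _ ≤ ∫ _ω, ε ∂μ := by
          refine integral_mono_ae integrable_condExp (integrable_const ε) ?_
          filter_upwards [h.condExp_roundRegret_le hP hD hδ hδ1 hε hε1 (hP _ hstar) t] with ω hω
          have : I.greedy t ω = πstar :=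
            Finset.card_le_one.mp hcard.le _ (h.greedy_mem t ω) _ hstar
          rw [this] at hω
          simpa using hω
      _ = ε := by simp
  calc _ ≤ ∑ _t ∈ Finset.range T, ε := Finset.sum_le_sum fun t _ => hround t
    _ = T * ε := by simp

lemma ae_sum_condExp_roundRegret_le (h : I.IsRun ℱ μ D P ε δ) (hP : ∀ π ∈ P, Measurable π)
    (hD : ∀ᵐ z ∂D, ∀ b, z.2 b ∈ Set.Icc (0 : ℝ) 1) (hδ : 0 < δ) (hδ1 : δ < 1)
    (hε : 0 < ε) (hε1 : ε ≤ 1) (hstar : πstar ∈ P)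
    (hmin : ∀ π ∈ P, expLoss D πstar ≤ expLoss D π) (hcard : 2 ≤ P.card) (T : ℕ) :
    ∀ᵐ ω ∂μ, ω ∈ I.deviationEvent D P πstar ε δ →
      ∑ t ∈ Finset.range T, (μ[I.roundRegret πstar t | ℱ t]) ω
        ≤ 52 * √(K * T * Real.log (T * P.card / δ) / ε) + T * ε := by
  have hK := one_le_numActions (D := D) πstar
  filter_upwards [h.ae_loss_mem_Icc hD,
    ae_all_iff.mpr fun t => h.condExp_roundRegret_le hP hD hδ hδ1 hε hε1 (hP _ hstar) t,
    ae_all_iff.mpr fun t => h.ae_abs_condExp_roundRegret_le (πstar := πstar) hD t]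
    with ω hl hce hone hω
  set Λ := Real.log (T * P.card / δ) with hΛ
  have hround : ∀ t ∈ Finset.range T, (μ[I.roundRegret πstar t | ℱ t]) ω
      ≤ 26 * √(K * Λ / ε) * (1 / √((t : ℝ) + 1)) + ε := by
    intro t ht
    have htT := Finset.mem_range.mp ht
    have hΛ0 : 0 < Λ := log_pos_of_le (by omega) (by omega) hδ hδ1
    have hroot : √(K / ε * (Λ / (t + 1))) = √(K * Λ / ε) * (1 / √((t : ℝ) + 1)) := by
      rw [show (K : ℝ) / ε * (Λ / (t + 1)) = K * Λ / ε * (1 / ((t : ℝ) + 1)) by ring,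
        Real.sqrt_mul (by positivity), Real.sqrt_div zero_le_one, Real.sqrt_one]
    have h1 := (le_abs_self _).trans (hone t)
    have h2 := hce t
    rw [mul_assoc, ← hroot]
    rcases Nat.eq_zero_or_pos t with rfl | ht0
    -- The first round has no past data and hence no deviation bound; its regret is bounded by 1.
    · have h3 := sqrt_le_two_mul_sqrt hK hcard (by omega : 1 ≤ T) hε hε1 hδ hδ1 1
      rw [Nat.cast_one, Real.sqrt_one, mul_one, ← hΛ] at h3
      have h4 : (K : ℝ) / ε * (Λ / ((0 : ℕ) + 1)) = K * Λ / ε := by push_cast; ring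
      rw [h4]
      linarith [Real.sqrt_nonneg (K * Λ / ε)]
    · have h3 := h.gap_le_threshold hδ hδ1 hε hstar hmin hl hω ht0
      have h4 := min_one_threshold_le hK hcard ht0 htT hε hε1 hδ hδ1
      rcases min_le_iff.mp h4 with h5 | h5 <;> linarith
  calc _ ≤ ∑ t ∈ Finset.range T, (26 * √(K * Λ / ε) * (1 / √((t : ℝ) + 1)) + ε) :=
        Finset.sum_le_sum hround
    _ = 26 * √(K * Λ / ε) * ∑ t ∈ Finset.range T, 1 / √((t : ℝ) + 1) + T * ε := by
        rw [Finset.sum_add_distrib, Finset.mul_sum]; simp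
    _ ≤ 26 * √(K * Λ / ε) * (2 * √T) + T * ε := by gcongr; exact sum_inv_sqrt_le T
    _ = 52 * √(K * T * Λ / ε) + T * ε := by
        rw [show (K : ℝ) * T * Λ / ε = T * (K * Λ / ε) by ring, Real.sqrt_mul (by positivity)]
        ring

/-- The constant arises as `2 * (5/2 √T + 52 S + T ε)` with `√T ≤ 2 S`, which gives `(10 + 104) S +
2 T ε`. -/
theorem integral_regret_cond_le (h : I.IsRun ℱ μ D P ε δ) (hP : ∀ π ∈ P, Measurable π)
    (hD : ∀ᵐ z ∂D, ∀ b, z.2 b ∈ Set.Icc (0 : ℝ) 1) (hδ : 0 < δ) (hδ1 : δ < 1)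
    (hε : 0 < ε) (hε1 : ε ≤ 1) (hstar : πstar ∈ P)
    (hmin : ∀ π ∈ P, expLoss D πstar ≤ expLoss D π) {T : ℕ} (hT : 1 ≤ T) :
    ∫ ω, I.regret πstar T ω ∂μ[|I.deviationEvent D P πstar ε δ]
      ≤ 114 * rate K P.card T δ ε := by
  have hK := one_le_numActions (D := D) πstar
  have hN : 1 ≤ P.card := Finset.card_pos.mpr ⟨_, hstar⟩
  have hTε : 0 ≤ T * ε := by positivity
  unfold rate
  set S := √(K * T * Real.log (T * P.card / δ) / ε) with hS
  have hS0 : 0 ≤ S := Real.sqrt_nonneg _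
  rcases hN.eq_or_lt with hone | htwo
  · rw [deviationEvent_eq_univ I hδ hδ1 hε hstar hone.symm, cond_univ]
    linarith [h.integral_regret_le_of_card_eq_one hP hD hδ hδ1 hε hε1 hstar hone.symm T]
  set E := I.deviationEvent D P πstar ε δ with hE
  have hEm : MeasurableSet E := h.measurableSet_deviationEvent hP hstar
  have hEμ : 1 / 2 ≤ μ.real E := by
    linarith [h.one_sub_le_measureReal_deviationEvent hP hD hδ hδ1 hε hε1 hstar]
  have hnoise := h.setIntegral_sum_regretNoise_le hD (hP _ hstar) hT E
  have hdrift := h.ae_sum_condExp_roundRegret_le hP hD hδ hδ1 hε hε1 hstar hmin htwo T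
  set B := 52 * S + T * ε with hB
  have hB0 : 0 ≤ B := by positivity
  have hNi : Integrable (fun ω => ∑ t ∈ Finset.range T, regretNoise I ℱ μ πstar t ω) μ :=
    integrable_of_ae_abs_le
      ((measurable_sum_range (h.measurable_regretNoise (hP _ hstar)) T).mono (ℱ.le _) le_rfl)
      (ae_abs_sum_range_le (h.ae_abs_regretNoise_le hD) T)
  have hRi : Integrable (I.regret πstar T) μ :=
    integrable_of_ae_abs_le (h.measurable_regret (hP _ hstar) T) (h.ae_abs_regret_le hD T)
  have hsplit : ∫ ω in E, I.regret πstar T ω ∂μ ≤ 5 / 2 * √T + B := by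
    calc ∫ ω in E, I.regret πstar T ω ∂μ
        ≤ ∫ ω in E, (∑ t ∈ Finset.range T, regretNoise I ℱ μ πstar t ω + B) ∂μ := by
          refine setIntegral_mono_on_ae hRi.integrableOn
            (hNi.add (integrable_const B)).integrableOn hEm ?_
          filter_upwards [hdrift] with ω hω hωE
          have h1 := hω hωE
          rw [regret_eq_sum]
          simp only [regretNoise, Finset.sum_sub_distrib]
          linarith
      _ = ∫ ω in E, ∑ t ∈ Finset.range T, regretNoise I ℱ μ πstar t ω ∂μ + μ.real E * B := by
          rw [integral_add hNi.integrableOn (integrable_const B).integrableOn]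
          simp
      _ ≤ 5 / 2 * √T + B := by
          have : μ.real E * B ≤ B := mul_le_of_le_one_left hB0 measureReal_le_one
          linarith
  have hfinal := integral_cond_le hEμ (by positivity) hsplit
  have hroot := sqrt_le_two_mul_sqrt hK htwo hT hε hε1 hδ hδ1 T
  linarith

end Interaction.IsRun

/-! ### Tuning the exploration probability -/

section Tuning

variable {K N T : ℕ} {δ : ℝ}

/-- The minimizer of `rate` over all positive exploration probabilities. -/
noncomputable def freeEps (K N T : ℕ) (δ : ℝ) : ℝ :=
  (K * Real.log (T * N / δ) / (4 * T)) ^ (1 / 3 : ℝ)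

lemma tunedEps_eq_min : tunedEps K N T δ = min 1 (freeEps K N T δ) := rfl

lemma freeEps_pos (hK : 1 ≤ K) (hN : 1 ≤ N) (hT : 1 ≤ T) (hδ : 0 < δ) (hδ1 : δ < 1) :
    0 < freeEps K N T δ := by
  have hlog := log_pos_of_le hN hT hδ hδ1
  have hK0 : (0 : ℝ) < K := by exact_mod_cast hK
  have hT0 : (0 : ℝ) < T := by exact_mod_cast hT
  unfold freeEps
  positivity

lemma freeEps_pow_three (hN : 1 ≤ N) (hT : 1 ≤ T) (hδ : 0 < δ) (hδ1 : δ < 1) :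
    freeEps K N T δ ^ 3 = K * Real.log (T * N / δ) / (4 * T) := by
  have hlog := log_pos_of_le hN hT hδ hδ1
  unfold freeEps
  rw [← Real.rpow_natCast, ← Real.rpow_mul (by positivity)]
  norm_num

lemma tunedEps_mem_Ioc (hK : 1 ≤ K) (hN : 1 ≤ N) (hT : 1 ≤ T) (hδ : 0 < δ) (hδ1 : δ < 1) :
    tunedEps K N T δ ∈ Set.Ioc (0 : ℝ) 1 :=
  ⟨lt_min one_pos (freeEps_pos hK hN hT hδ hδ1), min_le_left _ _⟩

/-- In terms of the critical point `y = freeEps`, where `K log = 4 T y³`, the rate is a rational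
function of `√ε` and `√y`, so minimality can be checked by factoring instead of differentiating. -/
lemma rate_eq (hK : 1 ≤ K) (hN : 1 ≤ N) (hT : 1 ≤ T) (hδ : 0 < δ) (hδ1 : δ < 1) {ε : ℝ}
    (hε : 0 < ε) :
    rate K N T δ ε = 2 * T * √(freeEps K N T δ) ^ 3 / √ε + T * √ε ^ 2 := by
  have hy := freeEps_pos hK hN hT hδ hδ1
  have hy3 := freeEps_pow_three (K := K) hN hT hδ hδ1
  have hT0 : (0 : ℝ) < T := by exact_mod_cast hT
  set y := freeEps K N T δ
  have hlog : K * Real.log (T * N / δ) = 4 * T * y ^ 3 := by rw [hy3]; field_simp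
  unfold rate
  rw [Real.sq_sqrt hε.le]
  congr 1
  rw [show K * T * Real.log (T * N / δ) / ε = T * (K * Real.log (T * N / δ)) / ε by ring, hlog,
    Real.sqrt_eq_iff_mul_self_eq (by positivity) (by positivity)]
  symm
  calc 2 * T * √y ^ 3 / √ε * (2 * T * √y ^ 3 / √ε)
      = 4 * T ^ 2 * (√y ^ 2) ^ 3 / √ε ^ 2 := by ring
    _ = T * (4 * T * y ^ 3) / ε := by rw [Real.sq_sqrt hy.le, Real.sq_sqrt hε.le]; ring

lemma isMinOn_rate_tunedEps (hK : 1 ≤ K) (hN : 1 ≤ N) (hT : 1 ≤ T) (hδ : 0 < δ)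
    (hδ1 : δ < 1) : IsMinOn (rate K N T δ) (Set.Ioc 0 1) (tunedEps K N T δ) := by
  intro ε hε
  have hy := freeEps_pos hK hN hT hδ hδ1
  have hT0 : (0 : ℝ) < T := by exact_mod_cast hT
  rw [Set.mem_ofPred_eq, rate_eq hK hN hT hδ hδ1 (tunedEps_mem_Ioc hK hN hT hδ hδ1).1,
    rate_eq hK hN hT hδ hδ1 hε.1, tunedEps_eq_min]
  set y := freeEps K N T δ
  have hr : 0 < √y := Real.sqrt_pos.mpr hy
  have hs : 0 < √ε := Real.sqrt_pos.mpr hε.1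
  have hs1 : √ε ≤ 1 := Real.sqrt_le_one.mpr hε.2
  set s := √ε
  rcases le_total 1 y with h1 | h1
  · rw [min_eq_left h1, Real.sqrt_one]
    have hr1 : 1 ≤ √y := Real.one_le_sqrt.mpr h1
    set r := √y
    have hr3 : 1 ≤ r ^ 3 := one_le_pow₀ hr1
    rw [← sub_nonneg]
    -- Critical point beyond 1: the excess over the value at `ε = 1` has the factor `1 - s ≥ 0`, and
    -- `s (1 + s) ≤ 2 ≤ 2 r³`.
    have : 2 * T * r ^ 3 / s + T * s ^ 2 - (2 * T * r ^ 3 / 1 + T * 1 ^ 2)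
        = T * ((1 - s) * (2 * r ^ 3 - s * (1 + s))) / s := by field_simp; ring
    rw [this]
    have h2 : 0 ≤ 2 * r ^ 3 - s * (1 + s) := by nlinarith
    have h3 : 0 ≤ 1 - s := by linarith
    positivity
  · rw [min_eq_right h1]
    set r := √y
    rw [← sub_nonneg]
    -- The critical point is a double root: `2r³ - 3r²s + s³ = (r - s)² (2r + s)`.
    have : 2 * T * r ^ 3 / s + T * s ^ 2 - (2 * T * r ^ 3 / r + T * r ^ 2)
        = T * ((r - s) ^ 2 * (2 * r + s)) / s := by field_simp; ring
    rw [this]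
    positivity

lemma rate_freeEps (hK : 1 ≤ K) (hN : 1 ≤ N) (hT : 1 ≤ T) (hδ : 0 < δ) (hδ1 : δ < 1) :
    rate K N T δ (freeEps K N T δ) = 3 * (T * freeEps K N T δ) := by
  have hy := freeEps_pos hK hN hT hδ hδ1
  rw [rate_eq hK hN hT hδ hδ1 hy]
  have hr : 0 < √(freeEps K N T δ) := Real.sqrt_pos.mpr hy
  nth_rewrite 4 [← Real.sq_sqrt hy.le]
  field_simp
  ring

lemma mul_freeEps_le (hN : 1 ≤ N) (hT : 1 ≤ T) (hδ : 0 < δ) (hδ1 : δ < 1) :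
    T * freeEps K N T δ
      ≤ (T : ℝ) ^ (2 / 3 : ℝ) * (K * Real.log (T * N / δ)) ^ (1 / 3 : ℝ) := by
  have hlog := log_pos_of_le hN hT hδ hδ1
  have hT0 : (0 : ℝ) < T := by exact_mod_cast hT
  have h1 : freeEps K N T δ ≤ (K * Real.log (T * N / δ) / T) ^ (1 / 3 : ℝ) := by
    unfold freeEps
    gcongr
    linarith
  calc T * freeEps K N T δ ≤ T * (K * Real.log (T * N / δ) / T) ^ (1 / 3 : ℝ) := by gcongr
    _ = (T / (T : ℝ) ^ (1 / 3 : ℝ)) * (K * Real.log (T * N / δ)) ^ (1 / 3 : ℝ) := by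
        rw [Real.div_rpow (by positivity) hT0.le]; ring
    _ = _ := by
        congr 1
        nth_rewrite 1 [← Real.rpow_one (T : ℝ)]
        rw [← Real.rpow_sub hT0]
        norm_num

end Tuning

end ActiveGreedy

/-! ### Main theorem -/

theorem mainTheorem4 :
    ∃ C : ℝ, 0 < C ∧
      ∀ (X : Type*) (Ω : Type*) [MeasurableSpace X] [mΩ : MeasurableSpace Ω]
        (μ : Measure Ω) [IsProbabilityMeasure μ]
        (K : ℕ) (D : Measure (X × (Fin K → ℝ))) [IsProbabilityMeasure D]
        (P : Finset (X → Fin K)) (πstar : X → Fin K) (δ : ℝ),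
        (∀ᵐ z ∂D, ∀ b, z.2 b ∈ Set.Icc (0 : ℝ) 1) →
        (∀ π ∈ P, Measurable π) →
        πstar ∈ P →
        (∀ π ∈ P, ActiveGreedy.expLoss D πstar ≤ ActiveGreedy.expLoss D π) →
        0 < δ → δ < 1 →
        -- for every exploration probability
        (∀ (ε : ℝ) (I : ActiveGreedy.Interaction X Ω K) (ℱ : Filtration ℕ mΩ),
          0 < ε → ε ≤ 1 → I.IsRun ℱ μ D P ε δ →
            MeasurableSet (I.deviationEvent D P πstar ε δ) ∧
            1 - δ ≤ μ.real (I.deviationEvent D P πstar ε δ) ∧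
            ∀ T : ℕ, 1 ≤ T →
              Integrable (I.regret πstar T) μ[|I.deviationEvent D P πstar ε δ] ∧
              ∫ ω, I.regret πstar T ω ∂μ[|I.deviationEvent D P πstar ε δ]
                ≤ C * ActiveGreedy.rate K P.card T δ ε) ∧
        -- for the exploration probability that optimizes the bound at horizon `T`
        (∀ T : ℕ, 1 ≤ T →
          ActiveGreedy.tunedEps K P.card T δ ∈ Set.Ioc (0 : ℝ) 1 ∧
          IsMinOn (ActiveGreedy.rate K P.card T δ) (Set.Ioc 0 1)
            (ActiveGreedy.tunedEps K P.card T δ) ∧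
          ∀ (I : ActiveGreedy.Interaction X Ω K) (ℱ : Filtration ℕ mΩ),
            I.IsRun ℱ μ D P (ActiveGreedy.tunedEps K P.card T δ) δ →
              ∫ ω, I.regret πstar T ω
                  ∂μ[|I.deviationEvent D P πstar (ActiveGreedy.tunedEps K P.card T δ) δ]
                ≤ C * ((T : ℝ) ^ (2 / 3 : ℝ)
                    * (K * Real.log (T * P.card / δ)) ^ (1 / 3 : ℝ))) := by
  -- `342 = 3 * 114`: the regret bound has constant 114, and the rate at its unconstrained minimizer
  -- is `3 T * freeEps`.
  refine ⟨342, by norm_num, ?_⟩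
  intro X Ω _ mΩ μ _ K D _ P πstar δ hD hP hstar hmin hδ hδ1
  have hK : 1 ≤ K := ActiveGreedy.Interaction.IsRun.one_le_numActions (D := D) πstar
  have hN : 1 ≤ P.card := Finset.card_pos.mpr ⟨_, hstar⟩
  refine ⟨fun ε I ℱ hε hε1 h => ⟨h.measurableSet_deviationEvent hP hstar, ?_, fun T hT =>
    ⟨h.integrable_regret_cond hD (hP _ hstar) T _, ?_⟩⟩, fun T hT =>
    ⟨ActiveGreedy.tunedEps_mem_Ioc hK hN hT hδ hδ1,
      ActiveGreedy.isMinOn_rate_tunedEps hK hN hT hδ hδ1, fun I ℱ h => ?_⟩⟩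
  · linarith [h.one_sub_le_measureReal_deviationEvent hP hD hδ hδ1 hε hε1 hstar]
  · have hrate : 0 ≤ ActiveGreedy.rate K P.card T δ ε := by
      unfold ActiveGreedy.rate
      positivity
    linarith [h.integral_regret_cond_le hP hD hδ hδ1 hε hε1 hstar hmin hT]
  · have hT1 : (1 : ℝ) ≤ T := by exact_mod_cast hT
    have hmem := ActiveGreedy.tunedEps_mem_Ioc hK hN hT hδ hδ1
    have hle := ActiveGreedy.mul_freeEps_le (K := K) hN hT hδ hδ1
    have hy := ActiveGreedy.freeEps_pos hK hN hT hδ hδ1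
    -- If the minimizer is capped at 1, the rate itself may exceed the target, but the regret is at
    -- most `T ≤ T * freeEps`. Otherwise the rate at the minimizer is used.
    rcases le_total 1 (ActiveGreedy.freeEps K P.card T δ) with h1 | h1
    · have h2 := h.integral_regret_cond_le_horizon hD (hP _ hstar) T
        (I.deviationEvent D P πstar (ActiveGreedy.tunedEps K P.card T δ) δ)
      have h3 : (T : ℝ) ≤ T * ActiveGreedy.freeEps K P.card T δ :=
        le_mul_of_one_le_right (by linarith) h1
      linarith
    · have h2 := h.integral_regret_cond_le hP hD hδ hδ1 hmem.1 hmem.2 hstar hmin hT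
      have h3 : ActiveGreedy.rate K P.card T δ (ActiveGreedy.tunedEps K P.card T δ)
          = 3 * (T * ActiveGreedy.freeEps K P.card T δ) := by
        rw [ActiveGreedy.tunedEps_eq_min, min_eq_right h1,
          ActiveGreedy.rate_freeEps hK hN hT hδ hδ1]
      rw [h3] at h2
      linarith
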